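/- **Theorem (Centralized lower bound).** There is a numerical constant $c>0$ such that the following holds for all integers $M,K,R\ge 1$ and all reals $H,\Delta>0$ and $\sigma,\tau,\zeta\ge 0$ with $\sigma^2\le MKR\,\Delta H$. There are a dimension $d$, differentiable functions $F_1,\dots,F_M:\mathbb{R}^d\to\mathbb{R}$ with average $F=\frac1M\sum_{m}F_m$, probability distributions $\mathcal D_1,\dots,\mathcal D_M$ on a measurable space $\mathcal Z$, and oracle maps $s_z(x)\in\mathbb{R}$, $g_z(x)\in\mathbb{R}^d$ ($z\in\mathcal Z$, $x\in\mathbb{R}^d$) such that, for all $m,n\in[M]$ and $x,y\in\mathbb{R}^d$ (norms are Euclidean, resp. spectral): - ($H$-smoothness) $\|\nabla F_m(x)-\nabla F_m(y)\|\le H\|x-y\|$; - (bounded sub-optimality) $F(0)-\inf F\le\Delta$; - (second-order heterogeneity) the $F_m$ are twice differentiable and $\|\nabla^2F_m(x)-\nabla^2F_n(x)\|\le\tau$; - (first-order heterogeneity) $\|\nabla F_m(x)-\nabla F_n(x)\|\le H\zeta$; - (stochastic oracle) $\mathbb{E}_{z\sim\mathcal D_m}[s_z(x)]=F_m(x)$,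 $\mathbb{E}_{z\sim\mathcal D_m}[g_z(x)]=\nabla F_m(x)$, $\mathbb{E}_{z\sim\mathcal D_m}\|g_z(x)-\nabla F_m(x)\|^2\le\sigma^2$ and $\mathbb{E}_{z\sim\mathcal D_m}\|g_z(x)-g_z(y)\|^2\le H^2\|x-y\|^2$; and such that every centralized distributed zero-respecting algorithm with $R$ communication rounds and $K$ two-point oracle calls per machine and round has an output $x_R$ satisfying $$\mathbb{E}\,\|\nabla F(x_R)\|^2\;\ge\;c\left(\frac{\Delta H}{R}+\frac{\sigma^2}{MKR}+\Big(\frac{\sigma\Delta H}{MKR}\Big)^{2/3}\right).$$ Here a two-point oracle call on machine $m$ at a pair $(x,y)$ draws a fresh independent $z\sim\mathcal D_m$ and returns $(s_z(x),s_z(y),g_z(x),g_z(y))$. In each round every machine makes $K$ successive calls, and at the end of the round all answers are shared. An algorithm chooses each query of a machine by a deterministic rule, the same for all machines, from all answers on all machines in earlier rounds and that machine's own answers in the current round; the output is a function of all answers of the $R$ rounds and possibly of an independent random seed. It is *zero-respecting* if each queried point is nonzero only on coordinates on which some gradient estimate in the answers available to that query is nonzero (so the first query is at $0$), and the output is nonzero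 only on coordinates on which some gradient estimate received on any machine is nonzero. It is *centralized* if all queries of all machines within a round are the same pair of points. -/

import Mathlib

open MeasureTheory

/-- Euclidean space `ℝᵈ`. -/
abbrev Pt (d : ℕ) : Type := EuclideanSpace ℝ (Fin d)

/-- The coordinate support of a vector. -/
def coordSupport {d : ℕ} (v : Pt d) : Set (Fin d) := {i | v i ≠ 0}

/-- A two-point query: the two points at which the oracle is to be evaluated on one common datum. -/
abbrev Query (d : ℕ) : Type := Pt d × Pt d

/-- The answer of a two-point first-order oracle to a query `(x, y)`: function values and gradient
estimates at `x` and at `y`, all computed from the same random datum. -/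
structure Answer (d : ℕ) where
  valFst : ℝ
  valSnd : ℝ
  gradFst : Pt d
  gradSnd : Pt d

/-- The coordinates revealed by an answer: those on which one of its gradient estimates is nonzero. -/
def Answer.support {d : ℕ} (a : Answer d) : Set (Fin d) :=
  coordSupport a.gradFst ∪ coordSupport a.gradSnd

/-- A distributed problem on `M` machines together with its stochastic first-order oracles.
Machine `m` has the objective `F m` and the data distribution `D m`; on the datum `z` the oracle
reports at `x` the function value `s z x` and the gradient estimate `g z x`. -/
structure ProblemInstance (d M : ℕ) where
  Z : Type
  measZ : MeasurableSpace Z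
  D : Fin M → Measure Z
  probD : ∀ m, IsProbabilityMeasure (D m)
  F : Fin M → Pt d → ℝ
  s : Z → Pt d → ℝ
  g : Z → Pt d → Pt d

attribute [instance] ProblemInstance.measZ ProblemInstance.probD

namespace ProblemInstance

variable {d M : ℕ}

/-- The average objective `F = (1/M) ∑ₘ Fₘ`. -/
noncomputable def avg (P : ProblemInstance d M) (x : Pt d) : ℝ := (1 / (M : ℝ)) * ∑ m, P.F m x

/-- The oracle's answer to the two-point query `q` on the datum `z`. -/
def answer (P : ProblemInstance d M) (z : P.Z) (q : Query d) : Answer d where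
  valFst := P.s z q.1
  valSnd := P.s z q.2
  gradFst := P.g z q.1
  gradSnd := P.g z q.2

/-- Second-order smoothness: every `Fₘ` is differentiable with `H`-Lipschitz gradient. -/
def Smooth (P : ProblemInstance d M) (H : ℝ) : Prop :=
  ∀ m, Differentiable ℝ (P.F m) ∧
    ∀ x y, ‖gradient (P.F m) x - gradient (P.F m) y‖ ≤ H * ‖x - y‖

/-- Bounded function sub-optimality: `F(0) - inf F ≤ Δ`. -/
def BoundedSubopt (P : ProblemInstance d M) (Δ : ℝ) : Prop :=
  ∀ x, P.avg 0 - P.avg x ≤ Δ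

/-- Bounded second-order heterogeneity: the `Fₘ` are twice differentiable and
`‖∇²Fₘ(x) - ∇²Fₙ(x)‖ ≤ τ` in operator norm, for all `m`, `n` and `x`. -/
def BoundedSecondHet (P : ProblemInstance d M) (τ : ℝ) : Prop :=
  (∀ m, Differentiable ℝ (gradient (P.F m))) ∧
    ∀ m n x, ‖fderiv ℝ (gradient (P.F m)) x - fderiv ℝ (gradient (P.F n)) x‖ ≤ τ

/-- Uniformly bounded first-order heterogeneity: `‖∇Fₘ(x) - ∇Fₙ(x)‖ ≤ H ζ`. -/
def BoundedFirstHet (P : ProblemInstance d M) (H ζ : ℝ) : Prop :=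
  ∀ m n x, ‖gradient (P.F m) x - gradient (P.F n) x‖ ≤ H * ζ

/-- The requirements on the stochastic multi-point oracle: unbiased function values, unbiased
gradient estimates, variance at most `σ²`, and `H`-mean-squared smoothness of the estimates. -/
structure OracleConditions (P : ProblemInstance d M) (H σ : ℝ) : Prop where
  val_integrable : ∀ m x, Integrable (fun z => P.s z x) (P.D m)
  val_unbiased : ∀ m x, ∫ z, P.s z x ∂(P.D m) = P.F m x
  grad_integrable : ∀ m x, Integrable (fun z => P.g z x) (P.D m)
  grad_unbiased : ∀ m x, ∫ z, P.g z x ∂(P.D m) = gradient (P.F m) x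
  variance_integrable : ∀ m x,
    Integrable (fun z => ‖P.g z x - gradient (P.F m) x‖ ^ 2) (P.D m)
  variance_le : ∀ m x, ∫ z, ‖P.g z x - gradient (P.F m) x‖ ^ 2 ∂(P.D m) ≤ σ ^ 2
  meanSq_integrable : ∀ m x y, Integrable (fun z => ‖P.g z x - P.g z y‖ ^ 2) (P.D m)
  meanSq_smooth : ∀ m x y,
    ∫ z, ‖P.g z x - P.g z y‖ ^ 2 ∂(P.D m) ≤ H ^ 2 * ‖x - y‖ ^ 2

/-- The law of the data used in `R` rounds of `K` oracle calls on each machine: all draws are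
independent, and those of machine `m` have law `D m`. -/
noncomputable def sampleLaw (P : ProblemInstance d M) (K R : ℕ) :
    Measure (Fin R → Fin K → Fin M → P.Z) :=
  Measure.pi fun _ => Measure.pi fun _ => Measure.pi P.D

end ProblemInstance

/-- The record of the completed rounds, in order: in each of them, every machine's list of answers. -/
abbrev History (d M : ℕ) : Type := List (Fin M → List (Answer d))

/-- The coordinates revealed by a list of answers of one machine. -/
def ownRevealed {d : ℕ} (own : List (Answer d)) : Set (Fin d) :=
  {i | ∃ a ∈ own, i ∈ a.support}

/-- The coordinates revealed by all answers, on all machines, in the completed rounds. -/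
def pastRevealed {d M : ℕ} (past : History d M) : Set (Fin d) :=
  {i | ∃ round ∈ past, ∃ m, ∃ a ∈ round m, i ∈ a.support}

/-- An algorithm in the intermittent communication model with `M` machines. The next query of a
machine is a deterministic function, the same for all machines, of all answers on all machines in
the completed rounds and of the machine's own answers in the current round. The final output is
computed from all answers and, possibly, a random seed in `Ω` independent of the data. -/
structure DistAlgorithm (d M : ℕ) (Ω : Type) where
  query : History d M → List (Answer d) → Query d
  output : Ω → History d M → Pt d

namespace DistAlgorithm

variable {d M : ℕ} {Ω : Type}

/-- Distributed zero-respecting algorithms: queried points are nonzero only on coordinates revealed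
to the querying machine, and the output, which is the vector communicated in the last round, only
on coordinates revealed on some machine. (The first query is therefore at the origin.) -/
structure ZeroRespecting (A : DistAlgorithm d M Ω) : Prop where
  query_fst : ∀ past own,
    coordSupport (A.query past own).1 ⊆ ownRevealed own ∪ pastRevealed past
  query_snd : ∀ past own,
    coordSupport (A.query past own).2 ⊆ ownRevealed own ∪ pastRevealed past
  output : ∀ θ past, coordSupport (A.output θ past) ⊆ pastRevealed past

/-- Centralized algorithms: within a round, all queries on all machines are the same. -/
def Centralized (A : DistAlgorithm d M Ω) : Prop :=
  ∀ past own own', A.query past own = A.query past own'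

/-- The answers one machine receives in a round, calling its oracle successively on the data
`z 0, …, z (K - 1)`. -/
def machineRound (A : DistAlgorithm d M Ω) (P : ProblemInstance d M) {K : ℕ}
    (past : History d M) (z : Fin K → P.Z) : List (Answer d) :=
  (List.ofFn z).foldl (fun own zk => own ++ [P.answer zk (A.query past own)]) []

/-- The record of all `R` rounds, where machine `m` uses the datum `ω r k m` in its `k`-th call of
round `r`. -/
def transcript (A : DistAlgorithm d M Ω) (P : ProblemInstance d M) {K R : ℕ}
    (ω : Fin R → Fin K → Fin M → P.Z) : History d M :=
  (List.ofFn ω).foldl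
    (fun past zr => past ++ [fun m => A.machineRound P past fun k => zr k m]) []

/-- The expected squared gradient norm `𝔼 ‖∇F(x_R)‖²` of the output after `R` rounds with `K` oracle
calls per machine and round, over the data and the seed, as an extended nonnegative number. -/
noncomputable def expectedSqGrad [MeasurableSpace Ω] (A : DistAlgorithm d M Ω)
    (μ : Measure Ω) (P : ProblemInstance d M) (K R : ℕ) : ENNReal :=
  ∫⁻ p, ENNReal.ofReal (‖gradient P.avg (A.output p.1 (A.transcript P p.2))‖ ^ 2)
    ∂(μ.prod (P.sampleLaw K R))

end DistAlgorithm

/-! All machines get the same objective, so both heterogeneity bounds hold for any nonnegative `τ`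
and `ζ`. The objective is a zero-chain: from a point supported on the first `k` coordinates, the
gradient reveals at most coordinate `k + 1`. A Bernoulli variable of parameter `p` gates the oracle:
with probability `1 - p` its answer reveals nothing new. A centralized algorithm asks one fixed
query pair per round, so a round reveals at most one coordinate, and none if all its gates are
closed. The number of revealed coordinates is thus at most `R`, and at most the number of open
gates, whose mean is `M * K * R * p`. If `d > R` or `d ≥ 2 * M * K * R * p`, some coordinate stays
hidden with probability at least 1/2 (`half_le_bernoulliArray`), and the gradient is then large
(`quarter_le_norm_sq_chainGrad`).

The delicate point is mean-squared smoothness: the noise must cancel the newest gradient coordinate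
exactly, yet be Lipschitz with a constant independent of the dimension. Cancelling the excess of
each transition value over all later ones does this (`zeroChain_chain`, `sum_excess_sq_le`,
`sum_sq_excess_sub_le`).

Three choices of parameters give the three terms: an ungated chain of length `R + 1`, a
one-dimensional quadratic with a rarely opening gate, and a gated chain. Whichever term is largest
determines the instance used. -/

/-! ### The gated oracle and its moments. -/

/-- The Bernoulli law with parameter `p` on `Bool`. -/
noncomputable def bernoulliLaw (p : ℝ) : Measure Bool :=
  ENNReal.ofReal p • Measure.dirac true + ENNReal.ofReal (1 - p) • Measure.dirac false

theorem isProbabilityMeasure_bernoulliLaw {p : ℝ} (h0 : 0 < p) (h1 : p ≤ 1) :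
    IsProbabilityMeasure (bernoulliLaw p) := by
  constructor
  simp only [bernoulliLaw, Measure.coe_add, Measure.coe_smul, Pi.add_apply, Pi.smul_apply,
    measure_univ, smul_eq_mul, mul_one]
  rw [← ENNReal.ofReal_add h0.le (by linarith)]
  simp

theorem integral_bernoulliLaw {E : Type*} [NormedAddCommGroup E] [NormedSpace ℝ E]
    [CompleteSpace E] {p : ℝ} (h0 : 0 < p) (h1 : p ≤ 1) (f : Bool → E) :
    ∫ z, f z ∂(bernoulliLaw p) = p • f true + (1 - p) • f false := by
  have i1 : Integrable f (ENNReal.ofReal p • Measure.dirac true) :=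
    (Integrable.of_finite (μ := Measure.dirac true)).smul_measure ENNReal.ofReal_ne_top
  have i2 : Integrable f (ENNReal.ofReal (1 - p) • Measure.dirac false) :=
    (Integrable.of_finite (μ := Measure.dirac false)).smul_measure ENNReal.ofReal_ne_top
  rw [bernoulliLaw, integral_add_measure i1 i2,
    integral_smul_measure, integral_smul_measure, integral_dirac, integral_dirac,
    ENNReal.toReal_ofReal h0.le, ENNReal.toReal_ofReal (by linarith)]

/-- The centred and normalized Bernoulli variable `z / p - 1`. -/
noncomputable def noiseFactor (p : ℝ) (z : Bool) : ℝ := if z then 1 / p - 1 else -1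

/-- The gradient estimate `G x + (z / p - 1) • n x`. -/
noncomputable def noisyGradient {d : ℕ} (p : ℝ) (G n : Pt d → Pt d) (z : Bool) (x : Pt d) : Pt d :=
  G x + noiseFactor p z • n x

/-- The homogeneous problem in which every machine has the objective `f`, exact function values,
and the gradient estimate `noisyGradient p G n z x` with `z` a Bernoulli variable of parameter
`p`. -/
noncomputable def noisyInstance {d : ℕ} (M : ℕ) {p : ℝ} (h0 : 0 < p) (h1 : p ≤ 1)
    (f : Pt d → ℝ) (G n : Pt d → Pt d) : ProblemInstance d M where
  Z := Bool
  measZ := inferInstance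
  D := fun _ => bernoulliLaw p
  probD := fun _ => isProbabilityMeasure_bernoulliLaw h0 h1
  F := fun _ => f
  s := fun _ => f
  g := noisyGradient p G n

theorem gradient_eq_of_forall_hasGradientAt {d : ℕ} {f : Pt d → ℝ} {G : Pt d → Pt d}
    (h : ∀ x, HasGradientAt f (G x) x) : gradient f = G := funext fun x => (h x).gradient

/-- The noise factor has mean zero and second moment `(1 - p) / p`. Hence the estimate is unbiased,
the cross term in the mean-squared difference vanishes, and both second-moment conditions become
`hvar` and `hms`. -/
theorem oracleConditions_noisyInstance {d M : ℕ} {p H σ : ℝ} (h0 : 0 < p) (h1 : p ≤ 1)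
    {f : Pt d → ℝ} {G n : Pt d → Pt d} (hG : ∀ x, HasGradientAt f (G x) x)
    (hvar : ∀ x, (1 - p) / p * ‖n x‖ ^ 2 ≤ σ ^ 2)
    (hms : ∀ x y, ‖G x - G y‖ ^ 2 + (1 - p) / p * ‖n x - n y‖ ^ 2 ≤ H ^ 2 * ‖x - y‖ ^ 2) :
    (noisyInstance M h0 h1 f G n).OracleConditions H σ := by
  have hg := gradient_eq_of_forall_hasGradientAt hG
  have prob := isProbabilityMeasure_bernoulliLaw h0 h1
  have e1 : ∀ z x, ‖noisyGradient p G n z x - G x‖ ^ 2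
      = noiseFactor p z ^ 2 * ‖n x‖ ^ 2 := by
    intro z x
    simp [noisyGradient, norm_smul, mul_pow]
  have e2 : ∀ z x y, ‖noisyGradient p G n z x
      - noisyGradient p G n z y‖ ^ 2
      = ‖G x - G y‖ ^ 2 + 2 * noiseFactor p z * inner ℝ (G x - G y) (n x - n y)
        + noiseFactor p z ^ 2 * ‖n x - n y‖ ^ 2 := by
    intro z x y
    have : noisyGradient p G n z x - noisyGradient p G n z y
        = (G x - G y) + noiseFactor p z • (n x - n y) := by
      simp only [noisyGradient, smul_sub]; abel
    rw [this, norm_add_sq_real, inner_smul_right, norm_smul, mul_pow, Real.norm_eq_abs, sq_abs]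
    ring
  constructor
  · intro m x; exact Integrable.of_finite (μ := bernoulliLaw p)
  · intro m x
    change ∫ _z : Bool, f x ∂(bernoulliLaw p) = f x
    rw [integral_const, probReal_univ, one_smul]
  · intro m x; exact Integrable.of_finite (μ := bernoulliLaw p)
  · intro m x
    change ∫ z : Bool, G x + noiseFactor p z • n x ∂(bernoulliLaw p) = gradient f x
    rw [integral_bernoulliLaw h0 h1, hg]
    simp only [noiseFactor, if_true, Bool.false_eq_true, if_false]
    have : p • (G x + (1 / p - 1) • n x) + (1 - p) • (G x + (-1 : ℝ) • n x)
        = G x + (p * (1 / p) - 1) • n x := by module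
    rw [this, mul_one_div_cancel h0.ne']; simp
  · intro m x; exact Integrable.of_finite (μ := bernoulliLaw p)
  · intro m x
    change ∫ z : Bool, ‖noisyGradient p G n z x - gradient f x‖ ^ 2
      ∂(bernoulliLaw p) ≤ _
    rw [hg]
    simp only [e1]
    rw [integral_bernoulliLaw h0 h1]
    refine le_trans (le_of_eq ?_) (hvar x)
    simp only [noiseFactor, if_true, Bool.false_eq_true, if_false, smul_eq_mul]
    field_simp
    ring
  · intro m x y; exact Integrable.of_finite (μ := bernoulliLaw p)
  · intro m x y
    change ∫ z : Bool, ‖noisyGradient p G n z x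
      - noisyGradient p G n z y‖ ^ 2 ∂(bernoulliLaw p) ≤ _
    simp only [e2]
    rw [integral_bernoulliLaw h0 h1]
    refine le_trans (le_of_eq ?_) (hms x y)
    simp only [noiseFactor, if_true, Bool.false_eq_true, if_false, smul_eq_mul]
    field_simp
    ring

theorem avg_noisyInstance {d M : ℕ} (hM : 0 < M) {p : ℝ} (h0 : 0 < p) (h1 : p ≤ 1)
    (f : Pt d → ℝ) (G n : Pt d → Pt d) : (noisyInstance M h0 h1 f G n).avg = f := by
  funext x
  have : (M : ℝ) ≠ 0 := by positivity
  simp [ProblemInstance.avg, noisyInstance, this]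

/-! ### Zero-chains and the progress of an algorithm along them. -/

/-- The coordinates with index below `k`. -/
def below (d k : ℕ) : Set (Fin d) := {i | (i : ℕ) < k}

theorem below_mono {d k l : ℕ} (h : k ≤ l) : below d k ⊆ below d l :=
  fun _ hi => lt_of_lt_of_le hi h

/-- A stochastic zero-chain: the gradient map `G` and the noise map `n` reveal at most one new
coordinate, and their difference, the estimate on the datum `false`, reveals none. -/
structure ZeroChain {d : ℕ} (G n : Pt d → Pt d) : Prop where
  grad : ∀ k x, coordSupport x ⊆ below d k → coordSupport (G x) ⊆ below d (k + 1)
  noise : ∀ k x, coordSupport x ⊆ below d k → coordSupport (n x) ⊆ below d (k + 1)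
  sub : ∀ k x, coordSupport x ⊆ below d k → coordSupport (G x - n x) ⊆ below d k

section Progress

variable {d M K R : ℕ} {Ω : Type} {p : ℝ} {h0 : 0 < p} {h1 : p ≤ 1} {f : Pt d → ℝ}
  {G n : Pt d → Pt d} {A : DistAlgorithm d M Ω}

theorem coordSupport_noisyGradient (hc : ZeroChain G n) {k : ℕ} {x : Pt d}
    (hx : coordSupport x ⊆ below d k) (z : Bool) :
    coordSupport (noisyGradient p G n z x) ⊆ below d (k + if z then 1 else 0) := by
  cases z
  · have : noisyGradient p G n false x = G x - n x := by
      simp [noisyGradient, noiseFactor, sub_eq_add_neg]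
    rw [this]
    exact hc.sub k x hx
  · intro i hi
    by_contra hn
    have a1 : G x i = 0 := by
      by_contra h; exact hn (hc.grad k x hx h)
    have a2 : n x i = 0 := by
      by_contra h; exact hn (hc.noise k x hx h)
    exact hi (by simp [noisyGradient, a1, a2])

/-- This is where centralization enters: the query of a round is frozen at its value on an empty
list of own answers, so the `K` successive calls cannot build on one another. -/
theorem DistAlgorithm.Centralized.machineRound_eq (hC : A.Centralized)
    (P : ProblemInstance d M) (past : History d M) (z : Fin K → P.Z) :
    A.machineRound P past z = (List.ofFn z).map fun zk => P.answer zk (A.query past []) := by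
  have key : ∀ (l : List P.Z) (own : List (Answer d)),
      l.foldl (fun own zk => own ++ [P.answer zk (A.query past own)]) own
        = own ++ l.map fun zk => P.answer zk (A.query past []) := by
    intro l
    induction l with
    | nil => simp
    | cons a l ih => intro own; simp [ih, hC past own []]
  simp [DistAlgorithm.machineRound, key]

/-- `1` if some datum of the round is `true`, and `0` otherwise. -/
noncomputable def roundSuccess (ω : Fin K → Fin M → Bool) : ℕ :=
  open Classical in if ∃ k m, ω k m = true then 1 else 0

/-- Every query of the round is supported on coordinates revealed before it. All answers can
therefore only add the same next coordinate, and only an answer on the datum `true` can add it. -/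
theorem pastRevealed_append_round (hc : ZeroChain G n) (hZ : A.ZeroRespecting)
    (hC : A.Centralized) {past : History d M} {k : ℕ} (hp : pastRevealed past ⊆ below d k)
    (ω : Fin K → Fin M → Bool) :
    pastRevealed (past ++ [fun m => A.machineRound (noisyInstance M h0 h1 f G n) past
      fun j => ω j m]) ⊆ below d (k + roundSuccess ω) := by
  rintro i ⟨round, hr, m, a, ha, hi⟩
  rw [List.mem_append, List.mem_singleton] at hr
  rcases hr with hr | rfl
  · exact below_mono (Nat.le_add_right _ _) (hp ⟨round, hr, m, a, ha, hi⟩)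
  · have e := hC.machineRound_eq (noisyInstance M h0 h1 f G n) past fun j => ω j m
    replace ha : a ∈ A.machineRound (noisyInstance M h0 h1 f G n) past fun j => ω j m := ha
    rw [e, List.mem_map] at ha
    obtain ⟨z, hz, rfl⟩ := ha
    obtain ⟨j, hj⟩ := (List.mem_ofFn' _ _).1 hz
    change Bool at z
    replace hj : ω j m = z := hj
    have own : ownRevealed ([] : List (Answer d)) = ∅ := by simp [ownRevealed]
    have q1 : coordSupport (A.query past []).1 ⊆ below d k := fun i hi =>
      hp (by simpa [own] using hZ.query_fst past [] hi)
    have q2 : coordSupport (A.query past []).2 ⊆ below d k := fun i hi =>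
      hp (by simpa [own] using hZ.query_snd past [] hi)
    have hb : below d (k + if z then 1 else 0) ⊆ below d (k + roundSuccess ω) := by
      apply below_mono
      have : (if z then 1 else 0) ≤ roundSuccess ω := by
        cases z
        · simp
        · have : ∃ k m, ω k m = true := ⟨j, m, hj⟩
          simp [roundSuccess, this]
      omega
    rcases hi with hi | hi
    · exact hb (coordSupport_noisyGradient hc q1 z hi)
    · exact hb (coordSupport_noisyGradient hc q2 z hi)

theorem pastRevealed_transcript (hc : ZeroChain G n) (hZ : A.ZeroRespecting)
    (hC : A.Centralized) (ω : Fin R → Fin K → Fin M → Bool) :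
    pastRevealed (A.transcript (noisyInstance M h0 h1 f G n) ω)
      ⊆ below d (∑ r, roundSuccess (ω r)) := by
  have key : ∀ (l : List (Fin K → Fin M → Bool)) (past : History d M) (k : ℕ),
      pastRevealed past ⊆ below d k →
      pastRevealed (l.foldl (fun past zr => past ++ [fun m =>
        A.machineRound (noisyInstance M h0 h1 f G n) past fun k => zr k m]) past)
        ⊆ below d (k + (l.map roundSuccess).sum) := by
    intro l
    induction l with
    | nil => intro past k h; simpa using h
    | cons a l ih =>
      intro past k h
      have := ih _ _ (pastRevealed_append_round hc hZ hC h a (h0 := h0) (h1 := h1) (f := f))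
      rw [List.map_cons, List.sum_cons, ← add_assoc]
      exact this
  have := key (List.ofFn ω) [] 0 (by simp [pastRevealed])
  rw [List.map_ofFn, List.sum_ofFn, zero_add] at this
  exact this

theorem sum_roundSuccess_le_rounds (ω : Fin R → Fin K → Fin M → Bool) :
    ∑ r, roundSuccess (ω r) ≤ R := by
  calc ∑ r, roundSuccess (ω r) ≤ ∑ _r : Fin R, 1 :=
        Finset.sum_le_sum fun r _ => by unfold roundSuccess; split_ifs <;> simp
    _ = R := by simp

theorem sum_roundSuccess_le_sum (ω : Fin R → Fin K → Fin M → Bool) :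
    ∑ r, roundSuccess (ω r) ≤ ∑ r, ∑ k, ∑ m, (ω r k m).toNat := by
  refine Finset.sum_le_sum fun r _ => ?_
  unfold roundSuccess
  split_ifs with h
  · obtain ⟨k, m, hkm⟩ := h
    calc 1 = (ω r k m).toNat := by simp [hkm]
      _ ≤ ∑ m, (ω r k m).toNat :=
        Finset.single_le_sum (f := fun m => (ω r k m).toNat) (fun _ _ => Nat.zero_le _)
          (Finset.mem_univ m)
      _ ≤ _ := Finset.single_le_sum (f := fun k => ∑ m, (ω r k m).toNat)
          (fun _ _ => Nat.zero_le _) (Finset.mem_univ k)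
  · exact Nat.zero_le _

end Progress

/-! ### From progress to a bound on the expected gradient. -/

/-- The law of `R × K × M` independent Bernoulli variables. -/
noncomputable def bernoulliArray (p : ℝ) (M K R : ℕ) : Measure (Fin R → Fin K → Fin M → Bool) :=
  Measure.pi fun _ => Measure.pi fun _ => Measure.pi fun _ => bernoulliLaw p

theorem lintegral_sum_bernoulliArray {p : ℝ} (h0 : 0 < p) (h1 : p ≤ 1) (M K R : ℕ) :
    ∫⁻ ω, ((∑ r, ∑ k, ∑ m, (ω r k m).toNat : ℕ) : ENNReal) ∂(bernoulliArray p M K R)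
      = ENNReal.ofReal (M * K * R * p) := by
  have := isProbabilityMeasure_bernoulliLaw h0 h1
  have hm : ∀ r k m, ∫⁻ ω, ((ω r k m).toNat : ENNReal) ∂(bernoulliArray p M K R)
      = ENNReal.ofReal p := by
    intro r k m
    have e : MeasurePreserving (fun ω : Fin R → Fin K → Fin M → Bool => ω r k m)
        (bernoulliArray p M K R) (bernoulliLaw p) :=
      ((measurePreserving_eval (fun _ : Fin M => bernoulliLaw p) m).comp
        (measurePreserving_eval (fun _ : Fin K => Measure.pi fun _ : Fin M => bernoulliLaw p) k)).comp
        (measurePreserving_eval (fun _ : Fin R => Measure.pi fun _ : Fin K =>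
          Measure.pi fun _ : Fin M => bernoulliLaw p) r)
    rw [e.lintegral_comp (f := fun b : Bool => (b.toNat : ENNReal)) (measurable_of_countable _)]
    simp [bernoulliLaw, lintegral_add_measure, lintegral_smul_measure]
  have mb : ∀ r k m, Measurable fun ω : Fin R → Fin K → Fin M → Bool =>
      ((ω r k m).toNat : ENNReal) := fun r k m =>
    (measurable_of_countable (fun b : Bool => (b.toNat : ENNReal))).comp (by fun_prop)
  simp only [Nat.cast_sum]
  rw [lintegral_finsetSum _ (fun r _ => Finset.measurable_sum _ fun k _ =>
    Finset.measurable_sum _ fun m _ => mb r k m)]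
  simp_rw [lintegral_finsetSum _ (fun k _ => Finset.measurable_sum _ fun m _ => mb _ k m),
    lintegral_finsetSum _ (fun m _ => mb _ _ m), hm]
  simp only [Finset.sum_const, Finset.card_univ, Fintype.card_fin, nsmul_eq_mul]
  rw [ENNReal.ofReal_mul (by positivity), ENNReal.ofReal_mul (by positivity),
    ENNReal.ofReal_mul (by positivity)]
  simp only [ENNReal.ofReal_natCast]
  ring

/-- If `R < d` the event is certain. Otherwise Markov's inequality applies to the number of open
gates, whose mean is at most `d / 2`. -/
theorem half_le_bernoulliArray {p : ℝ} (h0 : 0 < p) (h1 : p ≤ 1) {M K R d : ℕ} (hd : 0 < d)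
    (h : R < d ∨ 2 * (M * K * R * p) ≤ d) :
    ENNReal.ofReal (1 / 2) ≤ bernoulliArray p M K R {ω | ∑ r, roundSuccess (ω r) < d} := by
  have i1 := isProbabilityMeasure_bernoulliLaw h0 h1
  have i2 : IsProbabilityMeasure (bernoulliArray p M K R) := by
    unfold bernoulliArray; infer_instance
  rcases h with h | h
  · have : {ω : Fin R → Fin K → Fin M → Bool | ∑ r, roundSuccess (ω r) < d} = Set.univ :=
      Set.eq_univ_of_forall fun ω => (sum_roundSuccess_le_rounds ω).trans_lt h
    rw [this, measure_univ, ENNReal.ofReal_le_one]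
    norm_num
  · have hs : MeasurableSet {ω : Fin R → Fin K → Fin M → Bool | ∑ r, roundSuccess (ω r) < d} :=
      (Set.toFinite _).measurableSet
    have bad : bernoulliArray p M K R {ω | ∑ r, roundSuccess (ω r) < d}ᶜ
        ≤ ENNReal.ofReal (1 / 2) := by
      have sub : {ω : Fin R → Fin K → Fin M → Bool | ∑ r, roundSuccess (ω r) < d}ᶜ
          ⊆ {ω | (d : ENNReal) ≤ ((∑ r, ∑ k, ∑ m, (ω r k m).toNat : ℕ) : ENNReal)} := by
        intro ω hω
        simp only [Set.mem_compl_iff, Set.mem_ofPred_eq, not_lt] at hω ⊢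
        exact_mod_cast hω.trans (sum_roundSuccess_le_sum ω)
      refine (measure_mono sub).trans ?_
      refine (meas_ge_le_lintegral_div (measurable_of_countable _).aemeasurable
        (by exact_mod_cast hd.ne') (ENNReal.natCast_ne_top d)).trans ?_
      rw [lintegral_sum_bernoulliArray h0 h1, ← ENNReal.ofReal_natCast,
        ← ENNReal.ofReal_div_of_pos (by exact_mod_cast hd)]
      apply ENNReal.ofReal_le_ofReal
      rw [div_le_iff₀ (by exact_mod_cast hd)]
      linarith
    have tot := prob_add_prob_compl (μ := bernoulliArray p M K R) hs
    have : ENNReal.ofReal (1 / 2) = 1 - ENNReal.ofReal (1 / 2) := by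
      rw [← ENNReal.ofReal_one, ← ENNReal.ofReal_sub _ (by norm_num)]; norm_num
    rw [this, tsub_le_iff_right, ← tot]
    gcongr

theorem le_expectedSqGrad_noisyInstance {d M K R : ℕ} (hM : 0 < M) (hd : 0 < d) {p ε : ℝ}
    (h0 : 0 < p) (h1 : p ≤ 1) (hε : 0 ≤ ε) {f : Pt d → ℝ} {G n : Pt d → Pt d}
    (hG : ∀ x, HasGradientAt f (G x) x) (hc : ZeroChain G n)
    (hlow : ∀ k < d, ∀ x, coordSupport x ⊆ below d k → ε ≤ ‖G x‖ ^ 2)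
    (h : R < d ∨ 2 * (M * K * R * p) ≤ d)
    {Ω : Type} [MeasurableSpace Ω] (μ : Measure Ω) [IsProbabilityMeasure μ]
    {A : DistAlgorithm d M Ω} (hZ : A.ZeroRespecting) (hC : A.Centralized) :
    ENNReal.ofReal (ε / 2) ≤ A.expectedSqGrad μ (noisyInstance M h0 h1 f G n) K R := by
  have i1 := isProbabilityMeasure_bernoulliLaw h0 h1
  have i2 : IsProbabilityMeasure (bernoulliArray p M K R) := by
    unfold bernoulliArray; infer_instance
  set S : Set (Fin R → Fin K → Fin M → Bool) := {ω | ∑ r, roundSuccess (ω r) < d} with hS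
  have hSm : MeasurableSet S := (Set.toFinite _).measurableSet
  have hU : MeasurableSet ((Set.univ : Set Ω) ×ˢ S) := MeasurableSet.univ.prod hSm
  have e : A.expectedSqGrad μ (noisyInstance M h0 h1 f G n) K R
      = ∫⁻ q, ENNReal.ofReal (‖G (A.output q.1
          (A.transcript (noisyInstance M h0 h1 f G n) q.2))‖ ^ 2)
          ∂(μ.prod (bernoulliArray p M K R)) := by
    rw [DistAlgorithm.expectedSqGrad, avg_noisyInstance hM,
      gradient_eq_of_forall_hasGradientAt hG]
    rfl
  rw [e]
  calc ENNReal.ofReal (ε / 2) = ENNReal.ofReal ε * ENNReal.ofReal (1 / 2) := by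
        rw [← ENNReal.ofReal_mul hε]; ring_nf
    _ ≤ ENNReal.ofReal ε * (μ.prod (bernoulliArray p M K R)) (Set.univ ×ˢ S) := by
        rw [Measure.prod_prod, measure_univ, one_mul]
        gcongr
        exact half_le_bernoulliArray h0 h1 hd h
    _ = ∫⁻ q, (Set.univ ×ˢ S).indicator (fun _ => ENNReal.ofReal ε) q
          ∂(μ.prod (bernoulliArray p M K R)) := by
        rw [lintegral_indicator_const hU]
    _ ≤ _ := by
        -- Comparing with a measurable indicator from below needs no measurability of the
        -- algorithm's output.
        refine lintegral_mono fun q => ?_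
        by_cases hq : q ∈ (Set.univ : Set Ω) ×ˢ S
        · rw [Set.indicator_of_mem hq]
          apply ENNReal.ofReal_le_ofReal
          exact hlow _ hq.2 _ ((hZ.output _ _).trans (pastRevealed_transcript hc hZ hC q.2))
        · rw [Set.indicator_of_notMem hq]
          exact zero_le

/-! ### Reduction to a zero-chain with analytic bounds. -/

/-- `HardInstance M K R H Δ σ τ ζ ε`: some problem with the required regularity forces every
centralized zero-respecting algorithm to have expected squared gradient norm at least `ε`. -/
def HardInstance (M K R : ℕ) (H Δ σ τ ζ ε : ℝ) : Prop :=
  ∃ (d : ℕ) (P : ProblemInstance d M),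
    P.Smooth H ∧ P.BoundedSubopt Δ ∧ P.BoundedSecondHet τ ∧ P.BoundedFirstHet H ζ ∧
    P.OracleConditions H σ ∧
    ∀ (Ω : Type) [MeasurableSpace Ω] (μ : Measure Ω) [IsProbabilityMeasure μ]
      (A : DistAlgorithm d M Ω), A.ZeroRespecting → A.Centralized →
      ENNReal.ofReal ε ≤ A.expectedSqGrad μ P K R

theorem HardInstance.mono {M K R : ℕ} {H Δ σ τ ζ ε ε' : ℝ}
    (h : HardInstance M K R H Δ σ τ ζ ε) (hε : ε' ≤ ε) : HardInstance M K R H Δ σ τ ζ ε' := by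
  obtain ⟨d, P, a1, a2, a3, a4, a5, a6⟩ := h
  exact ⟨d, P, a1, a2, a3, a4, a5, fun Ω _ μ _ A hZ hC =>
    (ENNReal.ofReal_le_ofReal hε).trans (a6 Ω μ A hZ hC)⟩

theorem HardInstance.of_zeroChain {d M K R : ℕ} {H Δ σ τ ζ p ε : ℝ} (hM : 0 < M) (hd : 0 < d)
    (hH : 0 < H) (hτ : 0 ≤ τ) (hζ : 0 ≤ ζ) (h0 : 0 < p) (h1 : p ≤ 1) (hε : 0 ≤ ε)
    {f : Pt d → ℝ} {G n : Pt d → Pt d}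
    (hG : ∀ x, HasGradientAt f (G x) x) (hGd : Differentiable ℝ G)
    (hΔ : ∀ x, f 0 - f x ≤ Δ)
    (hvar : ∀ x, (1 - p) / p * ‖n x‖ ^ 2 ≤ σ ^ 2)
    (hms : ∀ x y, ‖G x - G y‖ ^ 2 + (1 - p) / p * ‖n x - n y‖ ^ 2 ≤ H ^ 2 * ‖x - y‖ ^ 2)
    (hc : ZeroChain G n)
    (hlow : ∀ k < d, ∀ x, coordSupport x ⊆ below d k → ε ≤ ‖G x‖ ^ 2)
    (h : R < d ∨ 2 * (M * K * R * p) ≤ d) :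
    HardInstance M K R H Δ σ τ ζ (ε / 2) := by
  have hg := gradient_eq_of_forall_hasGradientAt hG
  refine ⟨d, noisyInstance M h0 h1 f G n, ?_, ?_, ⟨?_, ?_⟩, ?_,
    oracleConditions_noisyInstance h0 h1 hG hvar hms, ?_⟩
  · refine fun m => ⟨fun x => (hG x).differentiableAt, fun x y => ?_⟩
    change ‖gradient f x - gradient f y‖ ≤ _
    -- Smoothness of the objective is mean-squared smoothness with the nonnegative noise term
    -- dropped.
    rw [hg]
    refine le_of_sq_le_sq ?_ (by positivity)
    have : 0 ≤ (1 - p) / p * ‖n x - n y‖ ^ 2 :=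
      mul_nonneg (div_nonneg (by linarith) h0.le) (sq_nonneg _)
    rw [mul_pow]
    linarith [hms x y]
  · intro x
    rw [avg_noisyInstance hM]
    exact hΔ x
  · intro m
    change Differentiable ℝ (gradient f)
    rw [hg]; exact hGd
  · intro m m' x
    simpa [noisyInstance] using hτ
  · intro m m' x
    simpa [noisyInstance] using mul_nonneg hH.le hζ
  · intro Ω _ μ _ A hZ hC
    exact le_expectedSqGrad_noisyInstance hM hd h0 h1 hε hG hc hlow h μ hZ hC

/-! ### Suffix maxima -/

/-- The maximum of `0` and the `n` terms `a j, …, a (j + n - 1)`. -/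
noncomputable def windowMax (a : ℕ → ℝ) : ℕ → ℕ → ℝ
  | 0, _ => 0
  | n + 1, j => max (a j) (windowMax a n (j + 1))

/-- The maximum of `0` and the terms `a j, …, a T`. -/
noncomputable def suffixMax (a : ℕ → ℝ) (T j : ℕ) : ℝ := windowMax a (T + 1 - j) j

theorem suffixMax_of_le (a : ℕ → ℝ) {T j : ℕ} (h : j ≤ T) :
    suffixMax a T j = max (a j) (suffixMax a T (j + 1)) := by
  have e : T + 1 - j = (T + 1 - (j + 1)) + 1 := by omega
  rw [suffixMax, e]
  rfl

theorem suffixMax_succ_self (a : ℕ → ℝ) (T : ℕ) : suffixMax a T (T + 1) = 0 := by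
  simp [suffixMax, windowMax]

theorem windowMax_nonneg (a : ℕ → ℝ) (n j : ℕ) : 0 ≤ windowMax a n j := by
  induction n generalizing j with
  | zero => exact le_rfl
  | succ n ih => exact (ih (j + 1)).trans (le_max_right _ _)

theorem suffixMax_nonneg (a : ℕ → ℝ) (T j : ℕ) : 0 ≤ suffixMax a T j := windowMax_nonneg _ _ _

theorem windowMax_le {a : ℕ → ℝ} {b : ℝ} (hb : 0 ≤ b) (n j : ℕ) (h : ∀ k ≥ j, a k ≤ b) :
    windowMax a n j ≤ b := by
  induction n generalizing j with
  | zero => exact hb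
  | succ n ih => exact max_le (h j le_rfl) (ih (j + 1) fun k hk => h k (by omega))

theorem suffixMax_le {a : ℕ → ℝ} {b : ℝ} (hb : 0 ≤ b) (T j : ℕ) (h : ∀ k ≥ j, a k ≤ b) :
    suffixMax a T j ≤ b := windowMax_le hb _ _ h

theorem suffixMax_eq_zero {a : ℕ → ℝ} (T j : ℕ) (h : ∀ k ≥ j, a k = 0) : suffixMax a T j = 0 :=
  le_antisymm (suffixMax_le le_rfl T j fun k hk => (h k hk).le) (suffixMax_nonneg a T j)

/-- The increment by which `a i` exceeds all later terms up to `a T`. -/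
noncomputable def excess (a : ℕ → ℝ) (T i : ℕ) : ℝ := a i - min (a i) (suffixMax a T (i + 1))

/-- Since `max + min` is the sum of the two terms, the excess is a difference of consecutive suffix
maxima and telescopes. -/
theorem excess_eq_sub (a : ℕ → ℝ) {T i : ℕ} (h : i ≤ T) :
    excess a T i = suffixMax a T i - suffixMax a T (i + 1) := by
  rw [excess, suffixMax_of_le a h, sub_eq_sub_iff_add_eq_add, max_add_min]

theorem excess_nonneg (a : ℕ → ℝ) (T i : ℕ) : 0 ≤ excess a T i :=
  sub_nonneg.2 (min_le_left _ _)

/-- Each excess lies in `[0, 1]`, so its square is at most itself, and the excesses telescope. The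
bound does not grow with `T`. -/
theorem sum_excess_sq_le {a : ℕ → ℝ} (T : ℕ) (h0 : ∀ k, 0 ≤ a k) (h1 : ∀ k, a k ≤ 1) :
    ∑ i ∈ Finset.range T, excess a T i ^ 2 ≤ 1 := by
  have hle : ∀ i, excess a T i ≤ 1 := fun i => by
    have : 0 ≤ min (a i) (suffixMax a T (i + 1)) := le_min (h0 i) (suffixMax_nonneg _ _ _)
    rw [excess]; linarith [h1 i]
  calc ∑ i ∈ Finset.range T, excess a T i ^ 2
      ≤ ∑ i ∈ Finset.range T, (suffixMax a T i - suffixMax a T (i + 1)) := by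
        refine Finset.sum_le_sum fun i hi => ?_
        rw [← excess_eq_sub a (Finset.mem_range.1 hi).le]
        nlinarith [hle i, excess_nonneg a T i]
    _ = suffixMax a T 0 - suffixMax a T T := Finset.sum_range_sub' _ _
    _ ≤ 1 := by
        linarith [suffixMax_nonneg a T T, suffixMax_le zero_le_one T 0 fun k _ => h1 k]

/-- Sorting a pair is nonexpansive in the Euclidean norm: it preserves norms, and pairing two sorted
pairs can only increase their inner product. -/
theorem sq_max_sub_add_sq_min_sub_le (a m b l : ℝ) :
    (max a m - max b l) ^ 2 + (min a m - min b l) ^ 2 ≤ (a - b) ^ 2 + (m - l) ^ 2 := by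
  rcases le_total a m with h | h <;> rcases le_total b l with h' | h' <;>
    simp only [max_eq_left, max_eq_right, min_eq_left, min_eq_right, h, h'] <;>
    nlinarith [mul_nonneg (sub_nonneg.2 h) (sub_nonneg.2 h')]

/-- With `δ = a i - b i` and `u` the difference of the minima, the excesses differ by `δ - u`, whose
square is at most `2δ² + 2u²`. Sorting gives `u² ≤ δ² + D (i + 1) - D i`, and `D` telescopes, so the
constant is independent of `T`. The boundary term `D T` is absorbed by the extra index `T` on the
right. -/
theorem sum_sq_excess_sub_le (a b : ℕ → ℝ) (T : ℕ) :
    ∑ i ∈ Finset.range T, (excess a T i - excess b T i) ^ 2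
      ≤ 4 * ∑ i ∈ Finset.range (T + 1), (a i - b i) ^ 2 := by
  set D : ℕ → ℝ := fun i => (suffixMax a T i - suffixMax b T i) ^ 2 with hD
  have step : ∀ i ∈ Finset.range T, (excess a T i - excess b T i) ^ 2
      ≤ 4 * (a i - b i) ^ 2 + 2 * (D (i + 1) - D i) := by
    intro i hi
    have hi := (Finset.mem_range.1 hi).le
    have := sq_max_sub_add_sq_min_sub_le (a i) (suffixMax a T (i + 1)) (b i)
      (suffixMax b T (i + 1))
    rw [← suffixMax_of_le a hi, ← suffixMax_of_le b hi] at this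
    simp only [hD, excess]
    set u := min (a i) (suffixMax a T (i + 1)) - min (b i) (suffixMax b T (i + 1)) with hu
    have e : a i - min (a i) (suffixMax a T (i + 1)) - (b i - min (b i) (suffixMax b T (i + 1)))
        = (a i - b i) - u := by rw [hu]; ring
    rw [e]
    nlinarith [sq_nonneg (a i - b i + u)]
  refine (Finset.sum_le_sum step).trans ?_
  rw [Finset.sum_add_distrib, ← Finset.mul_sum, ← Finset.mul_sum, Finset.sum_range_sub,
    Finset.sum_range_succ]
  have h1 : D T ≤ (a T - b T) ^ 2 := by
    have := sq_max_sub_add_sq_min_sub_le (a T) 0 (b T) 0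
    simp only [hD, suffixMax_of_le _ le_rfl, suffixMax_succ_self]
    nlinarith [sq_nonneg (min (a T) 0 - min (b T) 0)]
  have h2 : 0 ≤ D 0 := sq_nonneg _
  nlinarith [sq_nonneg (a T - b T)]

/-! ### One-dimensional building blocks -/

/-- The derivative of the smooth transition. -/
noncomputable def bumpD (t : ℝ) : ℝ := deriv Real.smoothTransition t

theorem hasDerivAt_smoothTransition (t : ℝ) :
    HasDerivAt Real.smoothTransition (bumpD t) t :=
  ((Real.smoothTransition.contDiff (n := 1)).differentiable (by simp) t).hasDerivAt

theorem bumpD_nonneg (t : ℝ) : 0 ≤ bumpD t := Real.smoothTransition.monotone.deriv_nonneg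

theorem contDiff_bumpD : ContDiff ℝ 1 bumpD := by
  have := (Real.smoothTransition.contDiff (n := 2))
  rw [show ((2 : ℕ∞) : WithTop ℕ∞) = 1 + 1 from rfl, contDiff_succ_iff_deriv] at this
  exact this.2.2

/-- The transition attains its global minimum there, so its derivative vanishes. -/
theorem bumpD_of_nonpos {t : ℝ} (h : t ≤ 0) : bumpD t = 0 := by
  apply IsLocalMin.deriv_eq_zero
  refine Filter.Eventually.of_forall fun s => ?_
  rw [Real.smoothTransition.zero_of_nonpos h]
  exact Real.smoothTransition.nonneg s

theorem bumpD_of_one_le {t : ℝ} (h : 1 ≤ t) : bumpD t = 0 := by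
  apply IsLocalMax.deriv_eq_zero
  refine Filter.Eventually.of_forall fun s => ?_
  rw [Real.smoothTransition.one_of_one_le h]
  exact Real.smoothTransition.le_one s

theorem hasCompactSupport_bumpD : HasCompactSupport bumpD :=
  HasCompactSupport.intro (isCompact_Icc (a := (0 : ℝ)) (b := 1)) fun t ht => by
    rw [Set.mem_Icc, not_and_or, not_le, not_le] at ht
    rcases ht with h | h
    · exact bumpD_of_nonpos h.le
    · exact bumpD_of_one_le h.le

/-- A common bound for the first derivative of the smooth transition and the Lipschitz constants of
the smooth transition and its derivative. -/
theorem exists_smoothTransition_bound : ∃ B : ℝ, 1 ≤ B ∧ (∀ t, bumpD t ≤ B) ∧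
    (∀ s t, |Real.smoothTransition s - Real.smoothTransition t| ≤ B * |s - t|) ∧
    ∀ s t, |bumpD s - bumpD t| ≤ B * |s - t| := by
  obtain ⟨C, hC⟩ := contDiff_bumpD.lipschitzWith_of_hasCompactSupport hasCompactSupport_bumpD
    (by simp)
  obtain ⟨E, hE⟩ := contDiff_bumpD.continuous.bounded_above_of_compact_support
    hasCompactSupport_bumpD
  refine ⟨max 1 (max C E), le_max_left _ _, fun t => ?_, fun s t => ?_, fun s t => ?_⟩
  · exact (le_abs_self _).trans ((hE t).trans ((le_max_right _ _).trans (le_max_right _ _)))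
  · have := Convex.norm_image_sub_le_of_norm_hasDerivWithin_le (s := Set.univ)
      (f := Real.smoothTransition) (f' := bumpD) (C := E) (x := t) (y := s)
      (fun x _ => (hasDerivAt_smoothTransition x).hasDerivWithinAt) (fun x _ => hE x)
      convex_univ (Set.mem_univ _) (Set.mem_univ _)
    exact this.trans (mul_le_mul_of_nonneg_right ((le_max_right _ _).trans (le_max_right _ _))
      (abs_nonneg _))
  · have := hC.dist_le_mul s t
    rw [Real.dist_eq, Real.dist_eq] at this
    exact this.trans (mul_le_mul_of_nonneg_right ((le_max_left _ _).trans (le_max_right _ _))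
      (abs_nonneg _))

/-- A constant as in `exists_smoothTransition_bound`. -/
noncomputable def bumpBound : ℝ := exists_smoothTransition_bound.choose

theorem one_le_bumpBound : 1 ≤ bumpBound := exists_smoothTransition_bound.choose_spec.1

theorem bumpD_le (t : ℝ) : bumpD t ≤ bumpBound := exists_smoothTransition_bound.choose_spec.2.1 t

theorem abs_smoothTransition_sub_le (s t : ℝ) :
    |Real.smoothTransition s - Real.smoothTransition t| ≤ bumpBound * |s - t| :=
  exists_smoothTransition_bound.choose_spec.2.2.1 s t

theorem abs_bumpD_sub_le (s t : ℝ) : |bumpD s - bumpD t| ≤ bumpBound * |s - t| :=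
  exists_smoothTransition_bound.choose_spec.2.2.2 s t

/-- A penalty for negative arguments, with derivative `-smoothTransition (-t)`. -/
noncomputable def negPenalty (t : ℝ) : ℝ := ∫ s in (0 : ℝ)..(-t), Real.smoothTransition s

theorem hasDerivAt_negPenalty (t : ℝ) :
    HasDerivAt negPenalty (-Real.smoothTransition (-t)) t := by
  have h := intervalIntegral.integral_hasDerivAt_right (a := (0 : ℝ)) (b := -t)
    (f := Real.smoothTransition)
    (Real.smoothTransition.continuous.intervalIntegrable _ _)
    (Real.smoothTransition.continuous.stronglyMeasurableAtFilter _ _)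
    Real.smoothTransition.continuousAt
  have := h.scomp t (hasDerivAt_neg t)
  rw [neg_one_smul] at this
  exact this

theorem negPenalty_zero : negPenalty 0 = 0 := by simp [negPenalty]

theorem negPenalty_nonneg (t : ℝ) : 0 ≤ negPenalty t := by
  rcases le_total t 0 with h | h
  · exact intervalIntegral.integral_nonneg (by linarith) fun s _ => Real.smoothTransition.nonneg s
  · have : negPenalty t = ∫ s in (0 : ℝ)..(-t), (0 : ℝ) := by
      refine intervalIntegral.integral_congr fun s hs => ?_
      rw [Set.uIcc_of_ge (by linarith)] at hs
      exact Real.smoothTransition.zero_of_nonpos hs.2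
    simp [this]

/-- A bounded positive increasing function. -/
noncomputable def ramp (t : ℝ) : ℝ := Real.arctan t + 2

/-- The derivative of `ramp`. -/
noncomputable def rampD (t : ℝ) : ℝ := 1 / (1 + t ^ 2)

theorem hasDerivAt_ramp (t : ℝ) : HasDerivAt ramp (rampD t) t :=
  (Real.hasDerivAt_arctan t).add_const 2

theorem ramp_nonneg (t : ℝ) : 0 ≤ ramp t := by
  unfold ramp; linarith [Real.neg_pi_div_two_lt_arctan t, Real.pi_lt_four]

theorem ramp_le (t : ℝ) : ramp t ≤ 4 := by
  unfold ramp; linarith [Real.arctan_lt_pi_div_two t, Real.pi_lt_four]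

theorem rampD_nonneg (t : ℝ) : 0 ≤ rampD t := by unfold rampD; positivity

theorem rampD_le (t : ℝ) : rampD t ≤ 1 := by
  unfold rampD
  rw [div_le_one (by positivity)]
  nlinarith [sq_nonneg t]

theorem rampD_zero : rampD 0 = 1 := by simp [rampD]

theorem half_le_rampD {t : ℝ} (h : |t| ≤ 1) : 1 / 2 ≤ rampD t := by
  have : t ^ 2 ≤ 1 := by rw [← sq_abs]; nlinarith [abs_nonneg t]
  unfold rampD
  apply one_div_le_one_div_of_le (by positivity)
  linarith

theorem differentiable_rampD : Differentiable ℝ rampD := fun t => by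
  unfold rampD
  exact (differentiableAt_const _).div (by fun_prop) (by positivity)

theorem abs_ramp_sub_le (s t : ℝ) : |ramp s - ramp t| ≤ |s - t| := by
  have := Convex.norm_image_sub_le_of_norm_hasDerivWithin_le (s := Set.univ)
      (f := ramp) (f' := rampD) (C := 1) (x := t) (y := s)
      (fun x _ => (hasDerivAt_ramp x).hasDerivWithinAt)
      (fun x _ => by rw [Real.norm_eq_abs, abs_of_nonneg (rampD_nonneg x)]; exact rampD_le x)
      convex_univ (Set.mem_univ _) (Set.mem_univ _)
  simpa using this

theorem abs_rampD_sub_le (s t : ℝ) : |rampD s - rampD t| ≤ |s - t| := by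
  have hs : 0 < 1 + s ^ 2 := by positivity
  have ht : 0 < 1 + t ^ 2 := by positivity
  have e : rampD s - rampD t = (t - s) * ((s + t) / ((1 + s ^ 2) * (1 + t ^ 2))) := by
    unfold rampD; field_simp; ring
  rw [e, abs_mul, abs_sub_comm t s]
  refine mul_le_of_le_one_right (abs_nonneg _) ?_
  rw [abs_div, abs_of_pos (mul_pos hs ht), div_le_one (mul_pos hs ht), abs_le]
  constructor <;> nlinarith [sq_nonneg (s + 1), sq_nonneg (s - 1), sq_nonneg (t + 1),
    sq_nonneg (t - 1), mul_nonneg (sq_nonneg s) (sq_nonneg t)]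

/-! ### The chain -/

/-- The coordinates of `x`, shifted by one, preceded by `1` and followed by zeros. -/
noncomputable def padded {d : ℕ} (x : Pt d) : ℕ → ℝ
  | 0 => 1
  | j + 1 => if h : j < d then x ⟨j, h⟩ else 0

theorem padded_of_lt {d : ℕ} (x : Pt d) {j : ℕ} (h : d < j) : padded x j = 0 := by
  obtain ⟨j, rfl⟩ := Nat.exists_eq_add_of_lt h
  simp [padded]

theorem padded_eq_zero {d k : ℕ} {x : Pt d} (h : coordSupport x ⊆ below d k) {j : ℕ}
    (hj : k < j) : padded x j = 0 := by
  cases j with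
  | zero => omega
  | succ j =>
    simp only [padded]
    split_ifs with hd
    · by_contra hn
      have : (j : ℕ) < k := h (show x ⟨j, hd⟩ ≠ 0 from hn)
      omega
    · rfl

/-- The leading entry 1 cancels in the difference and the entries beyond `d` vanish. The cutoff `T`
is free so that shifted windows are covered too. -/
theorem sum_sq_padded_sub_le {d : ℕ} (x y : Pt d) (T : ℕ) :
    ∑ j ∈ Finset.range T, (padded x j - padded y j) ^ 2 ≤ ‖x - y‖ ^ 2 := by
  have e : ‖x - y‖ ^ 2 = ∑ j ∈ Finset.range (d + 1), (padded x j - padded y j) ^ 2 := by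
    rw [Finset.sum_range_succ', ← Fin.sum_univ_eq_sum_range (fun j =>
      (padded x (j + 1) - padded y (j + 1)) ^ 2), EuclideanSpace.norm_sq_eq]
    simp [padded]
  rw [e]
  rcases le_total T (d + 1) with h | h
  · exact Finset.sum_le_sum_of_subset_of_nonneg (Finset.range_mono h) fun _ _ _ => sq_nonneg _
  · refine (Finset.sum_subset (Finset.range_mono h) fun j _ hj => ?_).ge
    rw [Finset.mem_range, not_lt] at hj
    rw [padded_of_lt x (by omega), padded_of_lt y (by omega)]
    simp

open Real in
/-- The unscaled hard function. -/
noncomputable def chainFun {d : ℕ} (x : Pt d) : ℝ :=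
  ∑ j ∈ Finset.range (d + 1), (negPenalty (padded x (j + 1))
    - smoothTransition (padded x j) * ramp (padded x (j + 1)))

open Real in
/-- The partial derivatives of `chainFun` in terms of the padded coordinates. -/
noncomputable def chainPartial (X : ℕ → ℝ) (j : ℕ) : ℝ :=
  -(smoothTransition (X j) * rampD (X (j + 1)) + bumpD (X (j + 1)) * ramp (X (j + 2))
    + smoothTransition (-X (j + 1)))

/-- The gradient of `chainFun`. -/
noncomputable def chainGrad {d : ℕ} (x : Pt d) : Pt d :=
  WithLp.toLp 2 fun i : Fin d => chainPartial (padded x) i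

/-- The noise direction of the oracle of the hard instance. -/
noncomputable def chainNoise {d : ℕ} (x : Pt d) : Pt d :=
  WithLp.toLp 2 fun i : Fin d => -excess (fun j => Real.smoothTransition (padded x j)) d i

/-- Each of the `d + 1` links can lower the value by at most 4, the bound on `ramp`. Sub-optimality
is linear in the length of the chain. -/
theorem chainFun_sub_le {d : ℕ} (x : Pt d) : chainFun (0 : Pt d) - chainFun x ≤ 4 * (d + 1) := by
  have h0 : chainFun (0 : Pt d) ≤ 0 := by
    refine Finset.sum_nonpos fun j _ => ?_
    have : padded (0 : Pt d) (j + 1) = 0 := by simp [padded]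
    rw [this, negPenalty_zero]
    linarith [mul_nonneg (Real.smoothTransition.nonneg (padded (0 : Pt d) j)) (ramp_nonneg 0)]
  have h1 : -(4 * (d + 1)) ≤ chainFun x := by
    have : ∑ j ∈ Finset.range (d + 1), (-4 : ℝ) ≤ chainFun x := by
      refine Finset.sum_le_sum fun j _ => ?_
      have := mul_le_mul (Real.smoothTransition.le_one (padded x j)) (ramp_le (padded x (j + 1)))
        (ramp_nonneg _) zero_le_one
      linarith [negPenalty_nonneg (padded x (j + 1))]
    simp at this
    linarith
  linarith

/-- On the first unrevealed coordinate only the term `smoothTransition (X k) * rampD 0` of the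
partial derivative survives, and `rampD 0 = 1`. All later transition values vanish, so the excess
there is exactly `smoothTransition (X k)`, and gradient and noise cancel. -/
theorem zeroChain_chain (d : ℕ) : ZeroChain (chainGrad (d := d)) chainNoise := by
  have hG : ∀ k x, coordSupport x ⊆ below d k → ∀ i : Fin d, k < i → chainGrad x i = 0 := by
    intro k x hx i hi
    simp [chainGrad, chainPartial, padded_eq_zero hx hi,
      padded_eq_zero hx (show k < (i : ℕ) + 1 by omega), Real.smoothTransition.zero,
      bumpD_of_nonpos le_rfl]
  have hS : ∀ k x, coordSupport x ⊆ below d k → ∀ i : Fin d, k ≤ i →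
      suffixMax (fun j => Real.smoothTransition (padded x j)) d (i + 1) = 0 := by
    intro k x hx i hi
    refine suffixMax_eq_zero _ _ fun j hj => ?_
    rw [padded_eq_zero hx (by omega), Real.smoothTransition.zero]
  have hN : ∀ k x, coordSupport x ⊆ below d k → ∀ i : Fin d, k < i → chainNoise x i = 0 := by
    intro k x hx i hi
    simp [chainNoise, excess, hS k x hx i hi.le, padded_eq_zero hx hi, Real.smoothTransition.zero]
  refine ⟨fun k x hx i hi => ?_, fun k x hx i hi => ?_, fun k x hx i hi => ?_⟩
  · by_contra h
    exact hi (hG k x hx i (by simp only [below, Set.mem_ofPred_eq] at h; omega))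
  · by_contra h
    exact hi (hN k x hx i (by simp only [below, Set.mem_ofPred_eq] at h; omega))
  · by_contra h
    have h : k ≤ (i : ℕ) := by simpa [below] using h
    apply hi
    rcases h.eq_or_lt with h' | h'
    · have z : padded x ((i : ℕ) + 1) = 0 := padded_eq_zero hx (by omega)
      simp [chainGrad, chainPartial, chainNoise, excess, hS k x hx i h, z, rampD_zero,
        Real.smoothTransition.zero, bumpD_of_nonpos le_rfl,
        Real.smoothTransition.nonneg]
    · simp [hG k x hx i h', hN k x hx i h']

theorem norm_sq_chainNoise_le {d : ℕ} (x : Pt d) : ‖chainNoise x‖ ^ 2 ≤ 1 := by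
  rw [EuclideanSpace.norm_sq_eq]
  refine le_trans (le_of_eq ?_) (sum_excess_sq_le
    (a := fun j => Real.smoothTransition (padded x j)) d
    (fun _ => Real.smoothTransition.nonneg _) (fun _ => Real.smoothTransition.le_one _))
  rw [← Fin.sum_univ_eq_sum_range (fun i =>
    excess (fun j => Real.smoothTransition (padded x j)) d i ^ 2)]
  simp [chainNoise]

theorem norm_sq_chainNoise_sub_le {d : ℕ} (x y : Pt d) :
    ‖chainNoise x - chainNoise y‖ ^ 2 ≤ 4 * bumpBound ^ 2 * ‖x - y‖ ^ 2 := by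
  rw [EuclideanSpace.norm_sq_eq]
  have h1 := sum_sq_excess_sub_le (fun j => Real.smoothTransition (padded x j))
    (fun j => Real.smoothTransition (padded y j)) d
  have h2 : ∑ j ∈ Finset.range (d + 1), (Real.smoothTransition (padded x j)
      - Real.smoothTransition (padded y j)) ^ 2
      ≤ ∑ j ∈ Finset.range (d + 1), bumpBound ^ 2 * (padded x j - padded y j) ^ 2 := by
    refine Finset.sum_le_sum fun j _ => ?_
    rw [← mul_pow]
    apply sq_le_sq.2
    rw [abs_mul, abs_of_nonneg (zero_le_one.trans one_le_bumpBound)]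
    exact abs_smoothTransition_sub_le _ _
  rw [← Finset.mul_sum] at h2
  have h3 := mul_le_mul_of_nonneg_left (sum_sq_padded_sub_le x y (d + 1)) (sq_nonneg bumpBound)
  rw [← Fin.sum_univ_eq_sum_range (fun i =>
    (excess (fun j => Real.smoothTransition (padded x j)) d i
      - excess (fun j => Real.smoothTransition (padded y j)) d i) ^ 2)] at h1
  calc _ = ∑ i : Fin d, (excess (fun j => Real.smoothTransition (padded x j)) d i
      - excess (fun j => Real.smoothTransition (padded y j)) d i) ^ 2 := by
        refine Finset.sum_congr rfl fun i _ => ?_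
        rw [Real.norm_eq_abs, sq_abs]
        simp only [chainNoise, PiLp.sub_apply]
        ring
    _ ≤ _ := by linarith

/-- Take the first padded entry below 1; its predecessor is at least 1, so the transition there
equals 1. In the corresponding partial derivative all terms have one sign. If the entry is at least
`-1`, `rampD` contributes at least 1/2; below `-1`, the penalty contributes 1. -/
theorem quarter_le_norm_sq_chainGrad {d k : ℕ} (hk : k < d) {x : Pt d}
    (hx : coordSupport x ⊆ below d k) : 1 / 4 ≤ ‖chainGrad x‖ ^ 2 := by
  classical
  have hex : ∃ j, padded x j < 1 := ⟨k + 1, by rw [padded_eq_zero hx (by omega)]; norm_num⟩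
  obtain ⟨j, hj⟩ : ∃ j, Nat.find hex = j + 1 := by
    refine Nat.exists_eq_succ_of_ne_zero fun h => ?_
    have := Nat.find_spec hex
    rw [h] at this
    simp [padded] at this
  have h1 : padded x (j + 1) < 1 := hj ▸ Nat.find_spec hex
  have h2 : 1 ≤ padded x j := not_lt.1 (Nat.find_min hex (by omega))
  have hjd : j < d := by
    have : Nat.find hex ≤ k + 1 := Nat.find_min' hex (by rw [padded_eq_zero hx (by omega)]; norm_num)
    omega
  have hpart : 1 / 2 ≤ -chainPartial (padded x) j := by
    rw [chainPartial, neg_neg, Real.smoothTransition.one_of_one_le h2, one_mul]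
    have p1 := mul_nonneg (bumpD_nonneg (padded x (j + 1))) (ramp_nonneg (padded x (j + 2)))
    have p2 := rampD_nonneg (padded x (j + 1))
    have p3 := Real.smoothTransition.nonneg (-padded x (j + 1))
    by_cases h : padded x (j + 1) < -1
    · have := Real.smoothTransition.one_of_one_le (x := -padded x (j + 1)) (by linarith)
      linarith
    · have := half_le_rampD (t := padded x (j + 1)) (abs_le.2 ⟨by linarith, h1.le⟩)
      linarith
  rw [EuclideanSpace.norm_sq_eq]
  refine le_trans ?_ (Finset.single_le_sum (f := fun i => ‖chainGrad x i‖ ^ 2)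
    (fun _ _ => sq_nonneg _) (Finset.mem_univ (⟨j, hjd⟩ : Fin d)))
  simp only [chainGrad, Real.norm_eq_abs, sq_abs]
  nlinarith

theorem abs_mul_sub_mul_le {a b a' b' A B : ℝ} (ha : |a| ≤ A) (hb : |b'| ≤ B) :
    |a * b - a' * b'| ≤ A * |b - b'| + B * |a - a'| := by
  have : a * b - a' * b' = a * (b - b') + b' * (a - a') := by ring
  rw [this]
  refine (abs_add_le _ _).trans ?_
  rw [abs_mul, abs_mul]
  gcongr

/-- The largest coefficient is that of the middle entry: with `B = bumpBound`, it is `1 + 4 * B + B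
≤ 6 * B`. -/
theorem abs_chainPartial_sub_le (X Y : ℕ → ℝ) (j : ℕ) :
    |chainPartial X j - chainPartial Y j| ≤ 6 * bumpBound *
      (|X j - Y j| + |X (j + 1) - Y (j + 1)| + |X (j + 2) - Y (j + 2)|) := by
  have hB := one_le_bumpBound
  have t1 : |Real.smoothTransition (X j) * rampD (X (j + 1))
      - Real.smoothTransition (Y j) * rampD (Y (j + 1))|
      ≤ |X (j + 1) - Y (j + 1)| + bumpBound * |X j - Y j| := by
    refine (abs_mul_sub_mul_le (A := 1) (B := 1) ?_ ?_).trans ?_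
    · rw [abs_of_nonneg (Real.smoothTransition.nonneg _)]; exact Real.smoothTransition.le_one _
    · rw [abs_of_nonneg (rampD_nonneg _)]; exact rampD_le _
    · linarith [abs_rampD_sub_le (X (j + 1)) (Y (j + 1)), abs_smoothTransition_sub_le (X j) (Y j)]
  have t2 : |bumpD (X (j + 1)) * ramp (X (j + 2)) - bumpD (Y (j + 1)) * ramp (Y (j + 2))|
      ≤ bumpBound * |X (j + 2) - Y (j + 2)| + 4 * (bumpBound * |X (j + 1) - Y (j + 1)|) := by
    refine (abs_mul_sub_mul_le (A := bumpBound) (B := 4) ?_ ?_).trans ?_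
    · rw [abs_of_nonneg (bumpD_nonneg _)]; exact bumpD_le _
    · rw [abs_of_nonneg (ramp_nonneg _)]; exact ramp_le _
    · have := abs_ramp_sub_le (X (j + 2)) (Y (j + 2))
      have := abs_bumpD_sub_le (X (j + 1)) (Y (j + 1))
      gcongr
  have t3 : |Real.smoothTransition (-X (j + 1)) - Real.smoothTransition (-Y (j + 1))|
      ≤ bumpBound * |X (j + 1) - Y (j + 1)| := by
    have := abs_smoothTransition_sub_le (-X (j + 1)) (-Y (j + 1))
    rwa [neg_sub_neg, abs_sub_comm (Y (j + 1))] at this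
  have e : chainPartial X j - chainPartial Y j
      = -((Real.smoothTransition (X j) * rampD (X (j + 1))
      - Real.smoothTransition (Y j) * rampD (Y (j + 1)))
      + (bumpD (X (j + 1)) * ramp (X (j + 2)) - bumpD (Y (j + 1)) * ramp (Y (j + 2)))
      + (Real.smoothTransition (-X (j + 1)) - Real.smoothTransition (-Y (j + 1)))) := by
    simp only [chainPartial]; ring
  rw [e, abs_neg]
  refine (abs_add_three _ _ _).trans ?_
  nlinarith [mul_nonneg (sub_nonneg.2 hB) (abs_nonneg (X (j + 1) - Y (j + 1))),
    mul_nonneg (zero_le_one.trans hB) (abs_nonneg (X j - Y j)),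
    mul_nonneg (zero_le_one.trans hB) (abs_nonneg (X (j + 1) - Y (j + 1))),
    mul_nonneg (zero_le_one.trans hB) (abs_nonneg (X (j + 2) - Y (j + 2)))]

/-- Each partial derivative sees only three consecutive entries, so no dimension factor appears:
`324 = 6² * 3 * 3`, with one 3 from squaring a sum of three terms and one from the three shifted
windows. -/
theorem norm_sq_chainGrad_sub_le {d : ℕ} (x y : Pt d) :
    ‖chainGrad x - chainGrad y‖ ^ 2 ≤ 324 * bumpBound ^ 2 * ‖x - y‖ ^ 2 := by
  set X := padded x
  set Y := padded y
  have hterm : ∀ j, (chainPartial X j - chainPartial Y j) ^ 2 ≤ 108 * bumpBound ^ 2 *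
      ((X j - Y j) ^ 2 + (X (j + 1) - Y (j + 1)) ^ 2 + (X (j + 2) - Y (j + 2)) ^ 2) := by
    intro j
    have h := abs_chainPartial_sub_le X Y j
    rw [← sq_abs (chainPartial X j - chainPartial Y j), ← sq_abs (X j - Y j),
      ← sq_abs (X (j + 1) - Y (j + 1)), ← sq_abs (X (j + 2) - Y (j + 2))]
    set a := |X j - Y j|
    set b := |X (j + 1) - Y (j + 1)|
    set c := |X (j + 2) - Y (j + 2)|
    refine (pow_le_pow_left₀ (abs_nonneg _) h 2).trans ?_
    rw [mul_pow]
    have : (a + b + c) ^ 2 ≤ 3 * (a ^ 2 + b ^ 2 + c ^ 2) := by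
      nlinarith [sq_nonneg (a - b), sq_nonneg (a - c), sq_nonneg (b - c)]
    nlinarith [mul_le_mul_of_nonneg_left this (sq_nonneg bumpBound)]
  have hs : ∀ k, ∑ j ∈ Finset.range d, (X (j + k) - Y (j + k)) ^ 2 ≤ ‖x - y‖ ^ 2 := by
    intro k
    refine le_trans ?_ (sum_sq_padded_sub_le x y (k + d))
    rw [Finset.sum_range_add]
    simp only [add_comm _ k]
    exact le_add_of_nonneg_left (Finset.sum_nonneg fun _ _ => sq_nonneg _)
  rw [EuclideanSpace.norm_sq_eq]
  calc ∑ i, ‖(chainGrad x - chainGrad y) i‖ ^ 2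
      = ∑ j ∈ Finset.range d, (chainPartial X j - chainPartial Y j) ^ 2 := by
        rw [← Fin.sum_univ_eq_sum_range (fun j => (chainPartial X j - chainPartial Y j) ^ 2)]
        simp [chainGrad, X, Y]
    _ ≤ ∑ j ∈ Finset.range d, 108 * bumpBound ^ 2 *
      ((X j - Y j) ^ 2 + (X (j + 1) - Y (j + 1)) ^ 2 + (X (j + 2) - Y (j + 2)) ^ 2) :=
        Finset.sum_le_sum fun j _ => hterm j
    _ ≤ _ := by
        rw [← Finset.mul_sum, Finset.sum_add_distrib, Finset.sum_add_distrib]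
        have h0 := hs 0
        simp only [add_zero] at h0
        have : ∑ j ∈ Finset.range d, (X j - Y j) ^ 2 + ∑ j ∈ Finset.range d, (X (j + 1) - Y (j + 1)) ^ 2
          + ∑ j ∈ Finset.range d, (X (j + 2) - Y (j + 2)) ^ 2 ≤ 3 * ‖x - y‖ ^ 2 := by
          linarith [hs 1, hs 2]
        nlinarith [mul_le_mul_of_nonneg_left this (sq_nonneg bumpBound)]

/-- The linear part of `padded`. -/
noncomputable def paddedD (d : ℕ) : ℕ → Pt d →L[ℝ] ℝ
  | 0 => 0
  | j + 1 => if h : j < d then EuclideanSpace.proj (⟨j, h⟩ : Fin d) else 0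

theorem hasFDerivAt_padded {d : ℕ} (x : Pt d) (j : ℕ) :
    HasFDerivAt (fun y : Pt d => padded y j) (paddedD d j) x := by
  cases j with
  | zero => exact hasFDerivAt_const _ _
  | succ j =>
    by_cases h : j < d
    · simp only [padded, paddedD, h, dif_pos]
      exact (EuclideanSpace.proj (𝕜 := ℝ) (⟨j, h⟩ : Fin d)).hasFDerivAt
    · simp only [padded, paddedD, h, dif_neg, not_false_eq_true]
      exact hasFDerivAt_const _ _

theorem hasGradientAt_chainFun {d : ℕ} (x : Pt d) : HasGradientAt chainFun (chainGrad x) x := by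
  rw [hasGradientAt_iff_hasFDerivAt]
  have h := HasFDerivAt.fun_sum (u := Finset.range (d + 1)) (x := x) fun j _ =>
    ((hasDerivAt_negPenalty _).comp_hasFDerivAt x (hasFDerivAt_padded x (j + 1))).sub
    (((hasDerivAt_smoothTransition _).comp_hasFDerivAt x (hasFDerivAt_padded x j)).mul
      ((hasDerivAt_ramp _).comp_hasFDerivAt x (hasFDerivAt_padded x (j + 1))))
  refine h.congr_fderiv ?_
  ext v
  have hz : paddedD d (d + 1) v = 0 := by simp [paddedD]
  have e : inner ℝ (chainGrad x) v
      = ∑ j ∈ Finset.range d, chainPartial (padded x) j * paddedD d (j + 1) v := by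
    rw [← Fin.sum_univ_eq_sum_range (fun j => chainPartial (padded x) j * paddedD d (j + 1) v),
      PiLp.inner_apply]
    refine Finset.sum_congr rfl fun i _ => ?_
    simp [chainGrad, paddedD, mul_comm]
  -- Each coordinate occurs in two neighbouring links, so the second sum is shifted by one. The
  -- unmatched ends vanish: `paddedD` is zero at index `d + 1`, beyond the coordinates, and at index
  -- 0, the constant entry.
  have e' : ∑ j ∈ Finset.range d, chainPartial (padded x) j * paddedD d (j + 1) v
      = ∑ j ∈ Finset.range (d + 1), (-(Real.smoothTransition (padded x j)
          * rampD (padded x (j + 1))) - Real.smoothTransition (-padded x (j + 1)))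
          * paddedD d (j + 1) v
        - ∑ j ∈ Finset.range (d + 1), bumpD (padded x j) * ramp (padded x (j + 1))
          * paddedD d j v := by
    rw [Finset.sum_range_succ, hz, Finset.sum_range_succ' (fun j => bumpD (padded x j)
      * ramp (padded x (j + 1)) * paddedD d j v)]
    simp only [paddedD, mul_zero, add_zero, zero_apply]
    rw [← Finset.sum_sub_distrib]
    refine Finset.sum_congr rfl fun j _ => ?_
    rw [chainPartial]
    ring
  rw [InnerProductSpace.toDual_apply_apply, e, e', ← Finset.sum_sub_distrib,
    sum_apply]
  refine Finset.sum_congr rfl fun j _ => ?_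
  simp only [sub_apply, add_apply,
    smul_apply, smul_eq_mul, Function.comp_apply]
  ring

theorem differentiable_chainGrad {d : ℕ} : Differentiable ℝ (chainGrad (d := d)) := by
  rw [differentiable_euclidean]
  intro i
  have hp : ∀ j, Differentiable ℝ fun x : Pt d => padded x j := fun j x =>
    (hasFDerivAt_padded x j).differentiableAt
  have h1 : Differentiable ℝ Real.smoothTransition := fun t =>
    (hasDerivAt_smoothTransition t).differentiableAt
  have h2 : Differentiable ℝ bumpD := contDiff_bumpD.differentiable (by simp)
  have h3 : Differentiable ℝ ramp := fun t => (hasDerivAt_ramp t).differentiableAt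
  simp only [chainGrad, chainPartial]
  exact ((((h1.comp (hp _)).mul (differentiable_rampD.comp (hp _))).add
    ((h2.comp (hp _)).mul (h3.comp (hp _)))).add (h1.comp (hp _).neg)).neg

/-! ### Rescaling the chain. -/

theorem coordSupport_comp_subset {d : ℕ} {G : Pt d → Pt d} {s t : Set (Fin d)} (S l : ℝ)
    (hG : ∀ x, coordSupport x ⊆ s → coordSupport (G x) ⊆ t) {x : Pt d} (hx : coordSupport x ⊆ s) :
    coordSupport (S • G (l • x)) ⊆ t := by
  have h1 : coordSupport (l • x) ⊆ s := fun i hi => hx (right_ne_zero_of_mul (a := l) hi)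
  exact fun i hi => hG _ h1 (right_ne_zero_of_mul (a := S) hi)

theorem ZeroChain.rescale {d : ℕ} {G n : Pt d → Pt d} (h : ZeroChain G n) (S l : ℝ) :
    ZeroChain (fun x => S • G (l • x)) (fun x => S • n (l • x)) where
  grad k _ hx := coordSupport_comp_subset S l (h.grad k) hx
  noise k _ hx := coordSupport_comp_subset S l (h.noise k) hx
  sub k x hx := by
    rw [← smul_sub]
    exact coordSupport_comp_subset (G := fun x => G x - n x) S l (h.sub k) hx

/-- Here `S` is the gradient scale and `l` the length scale. The `8` combines the gradient bound 1/4
with the probability 1/2. -/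
theorem HardInstance.of_rescaled_chain {d M K R : ℕ} {H Δ σ τ ζ p S l : ℝ} (hM : 0 < M)
    (hd : 0 < d) (hH : 0 < H) (hτ : 0 ≤ τ) (hζ : 0 ≤ ζ) (h0 : 0 < p) (h1 : p ≤ 1)
    (hS : 0 < S) (hl : 0 < l) (hΔ : S * l * (4 * (d + 1)) ≤ Δ)
    (hvar : (1 - p) / p * S ^ 2 ≤ σ ^ 2)
    (hms : (20 * bumpBound) ^ 2 * S ^ 2 ≤ p * H ^ 2 * l ^ 2)
    (h : R < d ∨ 2 * (M * K * R * p) ≤ d) :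
    HardInstance M K R H Δ σ τ ζ (S ^ 2 / 8) := by
  have key : HardInstance M K R H Δ σ τ ζ (S ^ 2 * (1 / 4) / 2) := by
    have hp : 0 ≤ (1 - p) / p := div_nonneg (by linarith) h0.le
    refine HardInstance.of_zeroChain hM hd hH hτ hζ h0 h1 (by positivity)
      (f := fun x => S * l * chainFun (l⁻¹ • x)) (G := fun x => S • chainGrad (l⁻¹ • x))
      (n := fun x => S • chainNoise (l⁻¹ • x)) ?_ ?_ ?_ ?_ ?_
      ((zeroChain_chain d).rescale S l⁻¹) ?_ h
    · intro x
      have g := hasGradientAt_chainFun (l⁻¹ • x)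
      rw [hasGradientAt_iff_hasFDerivAt] at g ⊢
      have := (g.comp x ((hasFDerivAt_id x).const_smul l⁻¹)).const_mul (S * l)
      refine this.congr_fderiv ?_
      ext v
      simp
      field_simp
    · exact (differentiable_chainGrad.comp (differentiable_id.const_smul l⁻¹)).const_smul S
    · intro x
      have := mul_le_mul_of_nonneg_left (chainFun_sub_le (l⁻¹ • x)) (mul_pos hS hl).le
      simp only [smul_zero]
      linarith
    · intro x
      refine le_trans ?_ hvar
      rw [norm_smul, mul_pow, Real.norm_eq_abs, sq_abs]
      exact mul_le_mul_of_nonneg_left (mul_le_of_le_one_right (sq_nonneg _)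
        (norm_sq_chainNoise_le _)) hp
    · intro x y
      have hxy : ‖l⁻¹ • x - l⁻¹ • y‖ ^ 2 = ‖x - y‖ ^ 2 / l ^ 2 := by
        rw [← smul_sub, norm_smul, mul_pow, Real.norm_eq_abs, sq_abs]
        field_simp
      have a1 := norm_sq_chainGrad_sub_le (l⁻¹ • x) (l⁻¹ • y)
      have a2 := norm_sq_chainNoise_sub_le (l⁻¹ • x) (l⁻¹ • y)
      rw [hxy] at a1 a2
      rw [← smul_sub, ← smul_sub, norm_smul, norm_smul, mul_pow, mul_pow, Real.norm_eq_abs, sq_abs]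
      set D := ‖x - y‖ ^ 2
      have hD : 0 ≤ D := sq_nonneg _
      have b1 := mul_le_mul_of_nonneg_left a1 (sq_nonneg S)
      have b2 := mul_le_mul_of_nonneg_left (mul_le_mul_of_nonneg_left a2 (sq_nonneg S)) hp
      refine (add_le_add b1 b2).trans ?_
      have e : S ^ 2 * (324 * bumpBound ^ 2 * (D / l ^ 2))
          + (1 - p) / p * (S ^ 2 * (4 * bumpBound ^ 2 * (D / l ^ 2)))
          = (324 * p + 4 * (1 - p)) * (bumpBound ^ 2 * S ^ 2) * (D / (p * l ^ 2)) := by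
        field_simp
      have e2 : H ^ 2 * D = p * H ^ 2 * l ^ 2 * (D / (p * l ^ 2)) := by field_simp
      rw [e, e2]
      -- The factor `20² = 400` dominates `324 * p + 4 * (1 - p)`.
      refine mul_le_mul_of_nonneg_right (le_trans ?_ hms) (by positivity)
      rw [mul_pow, mul_assoc]
      exact mul_le_mul_of_nonneg_right (by linarith) (by positivity)
    · intro k hk x hx
      have hx' : coordSupport (l⁻¹ • x) ⊆ below d k := fun i hi =>
        hx (right_ne_zero_of_mul (a := l⁻¹) hi)
      rw [norm_smul, mul_pow, Real.norm_eq_abs, sq_abs]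
      exact mul_le_mul_of_nonneg_left (quarter_le_norm_sq_chainGrad hk hx') (sq_nonneg S)
  exact key.mono (by linarith)

/-! ### The three hard instances. -/

theorem HardInstance.of_optimization_term {M K R : ℕ} {H Δ σ τ ζ : ℝ} (hM : 0 < M) (hR : 0 < R)
    (hH : 0 < H) (hΔ : 0 < Δ) (hτ : 0 ≤ τ) (hζ : 0 ≤ ζ) :
    HardInstance M K R H Δ σ τ ζ (Δ * H / R / (96 * (20 * bumpBound))) := by
  set b := 20 * bumpBound with hb
  have hb0 : 0 < b := by have := one_le_bumpBound; positivity
  have hR' : (1 : ℝ) ≤ R := by exact_mod_cast hR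
  have hS2 : 0 < Δ * H / (12 * b * R) := by positivity
  -- With `p = 1` there is no noise. The length `l = b * S / H` saturates smoothness, and the 12
  -- comes from `4 * (d + 1) = 4 * (R + 2) ≤ 12 * R`.
  set S := √(Δ * H / (12 * b * R)) with hSdef
  have hS : 0 < S := Real.sqrt_pos.2 hS2
  have hsq : S ^ 2 = Δ * H / (12 * b * R) := Real.sq_sqrt hS2.le
  refine (HardInstance.of_rescaled_chain (d := R + 1) (p := 1) (S := S) (l := b * S / H) hM
    (Nat.succ_pos R) hH hτ hζ one_pos le_rfl hS (by positivity) ?_ ?_ ?_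
    (Or.inl (Nat.lt_succ_self R))).mono ?_
  · have : S * (b * S / H) * (4 * (((R + 1 : ℕ) : ℝ) + 1)) = b * S ^ 2 / H * (4 * (R + 2)) := by
      push_cast; ring
    rw [this, hsq]
    have : b * (Δ * H / (12 * b * R)) / H * (4 * (R + 2)) = Δ * ((R + 2) / (3 * R)) := by
      field_simp; ring
    rw [this]
    refine mul_le_of_le_one_right hΔ.le ?_
    rw [div_le_one (by positivity)]
    linarith
  · simp [sq_nonneg]
  · rw [← hb]
    apply le_of_eq
    field_simp
  · rw [hsq]
    apply le_of_eq
    field_simp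
    norm_num

theorem HardInstance.of_variance_term {M K R : ℕ} {H Δ σ τ ζ : ℝ} (hM : 0 < M) (hK : 0 < K)
    (hR : 0 < R) (hH : 0 < H) (hτ : 0 ≤ τ) (hζ : 0 ≤ ζ)
    (hσ : σ ^ 2 ≤ (M * K * R : ℝ) * (Δ * H)) :
    HardInstance M K R H Δ σ τ ζ (σ ^ 2 / (M * K * R) / 4) := by
  have hN : (1 : ℝ) ≤ M * K * R := by exact_mod_cast Nat.mul_pos (Nat.mul_pos hM hK) hR
  set N : ℝ := M * K * R with hNdef
  have hN0 : 0 < N := by linarith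
  -- The minimizer `v` of the quadratic is placed at distance `a` from the origin, so that the
  -- gradient at 0 has squared norm `σ ^ 2 / (2 * N)`. The constant noise equals that gradient,
  -- hence a closed gate at 0 returns zero. With `p = 1 / (2 * N)` the variance is `(1 - p) * σ ^
  -- 2`.
  set a := √(σ ^ 2 / (2 * N)) / H with ha
  have ha2 : H ^ 2 * a ^ 2 = σ ^ 2 / (2 * N) := by
    rw [← mul_pow, ha, mul_div_cancel₀ _ hH.ne', Real.sq_sqrt (by positivity)]
  set v : Pt 1 := EuclideanSpace.single 0 a with hv
  have hvn : ‖v‖ ^ 2 = a ^ 2 := by simp [hv]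
  have hall : ∀ k (s : Set (Fin 1)), s ⊆ below 1 (k + 1) := fun k s i _ =>
    show (i : ℕ) < k + 1 by omega
  have hzero : ∀ x : Pt 1, coordSupport x ⊆ below 1 0 → x = 0 := by
    intro x hx
    ext i
    by_contra h
    exact absurd (hx h) (by simp [below])
  have key : HardInstance M K R H Δ σ τ ζ (σ ^ 2 / (2 * N) / 2) := by
    refine HardInstance.of_zeroChain (d := 1) (p := 1 / (2 * N)) hM one_pos hH hτ hζ
      (by positivity) ?_ (by positivity) (f := fun x => H / 2 * ‖x - v‖ ^ 2)
      (G := fun x => H • (x - v)) (n := fun _ => -(H • v)) ?_ ?_ ?_ ?_ ?_ ?_ ?_ (Or.inr ?_)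
    · rw [div_le_one (by positivity)]; linarith
    · intro x
      rw [hasGradientAt_iff_hasFDerivAt]
      have := (((hasFDerivAt_id x).sub_const v).norm_sq).const_mul (H / 2)
      refine this.congr_fderiv ?_
      ext w
      simp
      ring
    · exact (differentiable_id.sub_const v).const_smul H
    · intro x
      simp only [zero_sub, norm_neg, hvn]
      have h1 : H / 2 * a ^ 2 ≤ Δ := by
        have : H / 2 * a ^ 2 = σ ^ 2 / (4 * N * H) := by
          rw [eq_div_iff (by positivity)]
          have : H / 2 * a ^ 2 * (4 * N * H) = H ^ 2 * a ^ 2 * (2 * N) := by ring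
          rw [this, ha2]; field_simp
        rw [this, div_le_iff₀ (by positivity)]
        nlinarith [sq_nonneg σ]
      have : 0 ≤ H / 2 * ‖x - v‖ ^ 2 := by positivity
      linarith
    · intro x
      rw [norm_neg, norm_smul, mul_pow, hvn, Real.norm_eq_abs, sq_abs, ha2]
      have : (1 - 1 / (2 * N)) / (1 / (2 * N)) * (σ ^ 2 / (2 * N))
          = (1 - 1 / (2 * N)) * σ ^ 2 := by field_simp
      rw [this]
      refine mul_le_of_le_one_left (sq_nonneg _) ?_
      have : 0 ≤ 1 / (2 * N) := by positivity
      linarith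
    · intro x y
      rw [← smul_sub, sub_sub_sub_cancel_right, norm_smul, mul_pow, Real.norm_eq_abs, sq_abs]
      simp
    · refine ⟨fun k x _ => hall k _, fun k x _ => hall k _, fun k x hx => ?_⟩
      cases k with
      | zero =>
        rw [hzero x hx]
        simp [coordSupport]
      | succ k => exact hall k _
    · intro k hk x hx
      obtain rfl : k = 0 := by omega
      rw [hzero x hx, zero_sub, norm_smul, norm_neg, mul_pow, hvn, Real.norm_eq_abs, sq_abs, ha2]
    · apply le_of_eq
      rw [← hNdef]
      field_simp
      norm_num
  refine key.mono (le_of_eq ?_)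
  field_simp
  norm_num

theorem HardInstance.of_mixed_term {M K R : ℕ} {H Δ σ τ ζ u : ℝ} (hM : 0 < M)
    (hK : 0 < K) (hR : 0 < R) (hH : 0 < H) (hτ : 0 ≤ τ) (hζ : 0 ≤ ζ) (hσ : 0 < σ) (hu : 0 < u)
    (hu3 : u ^ 3 = σ * Δ * H / (M * K * R)) (huσ : u ≤ σ) (hσu : σ ^ 2 / (M * K * R) ≤ u ^ 2) :
    HardInstance M K R H Δ σ τ ζ (u ^ 2 / (2048 * (20 * bumpBound) ^ 2)) := by
  have hN : (1 : ℝ) ≤ M * K * R := by exact_mod_cast Nat.mul_pos (Nat.mul_pos hM hK) hR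
  set N : ℝ := M * K * R with hNdef
  have hN0 : 0 < N := by linarith
  set b := 20 * bumpBound with hb
  have hb1 : 1 ≤ b := by have := one_le_bumpBound; linarith
  have hb0 : 0 < b := by linarith
  -- The parameters are `S = κ * u`, `p = v ^ 2` and `l = b * σ / H`. The choice `v = S / σ` makes
  -- the variance `(1 - p) * σ ^ 2`, `l` saturates mean-squared smoothness, and `κ` makes the
  -- sub-optimality bound come out as `Δ`.
  set κ := 1 / (16 * b) with hκ
  have hκ0 : 0 < κ := by positivity
  have hκ1 : κ ≤ 1 := by rw [hκ, div_le_one (by positivity)]; linarith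
  set v := κ * u / σ with hv
  have hv0 : 0 < v := by positivity
  have hv1 : v ≤ 1 := by
    rw [hv, div_le_one hσ]; nlinarith
  have hNv : κ ^ 2 ≤ N * v ^ 2 := by
    have : N * v ^ 2 = κ ^ 2 * (N * u ^ 2 / σ ^ 2) := by rw [hv]; field_simp
    rw [this]
    refine le_mul_of_one_le_right (sq_nonneg _) ?_
    rw [one_le_div (by positivity)]
    rw [div_le_iff₀ hN0] at hσu
    linarith
  set d := ⌈2 * (N * v ^ 2)⌉₊ with hd
  have hdpos : 0 < d := Nat.ceil_pos.2 (by positivity)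
  -- Rounding up and the extra link cost at most 2, which `hσu` absorbs because it says `N * u ^ 2 /
  -- σ ^ 2 ≥ 1`.
  have hdle : (d : ℝ) + 1 ≤ 4 * N * u ^ 2 / σ ^ 2 := by
    have h1 : (d : ℝ) < 2 * (N * v ^ 2) + 1 := Nat.ceil_lt_add_one (by positivity)
    have h2 : N * v ^ 2 = κ ^ 2 * (N * u ^ 2 / σ ^ 2) := by rw [hv]; field_simp
    have h3 : 1 ≤ N * u ^ 2 / σ ^ 2 := by
      rw [h2] at hNv
      exact (le_mul_iff_one_le_right (by positivity)).1 hNv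
    have h4 : κ ^ 2 * (N * u ^ 2 / σ ^ 2) ≤ N * u ^ 2 / σ ^ 2 :=
      mul_le_of_le_one_left (by linarith) (by nlinarith)
    have h5 : 4 * N * u ^ 2 / σ ^ 2 = 4 * (N * u ^ 2 / σ ^ 2) := by ring
    rw [h5]
    linarith
  refine (HardInstance.of_rescaled_chain (d := d) (p := v ^ 2) (S := κ * u) (l := b * σ / H) hM
    hdpos hH hτ hζ (by positivity) (by nlinarith) (by positivity) (by positivity) ?_ ?_ ?_
    (Or.inr (Nat.le_ceil _))).mono ?_
  · have h1 : κ * u * (b * σ / H) * (4 * (4 * N * u ^ 2 / σ ^ 2)) = Δ := by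
      have : κ * u * (b * σ / H) * (4 * (4 * N * u ^ 2 / σ ^ 2))
          = (κ * (16 * b)) * (N * u ^ 3 / (H * σ)) := by field_simp; ring
      rw [this, hu3, hκ]
      field_simp
    calc κ * u * (b * σ / H) * (4 * (d + 1))
        ≤ κ * u * (b * σ / H) * (4 * (4 * N * u ^ 2 / σ ^ 2)) := by gcongr
      _ = Δ := h1
  · have : (1 - v ^ 2) / v ^ 2 * (κ * u) ^ 2 = (1 - v ^ 2) * σ ^ 2 := by
      have e : κ * u = v * σ := by rw [hv]; field_simp
      rw [e]; field_simp
    rw [this]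
    exact mul_le_of_le_one_left (sq_nonneg _) (by nlinarith)
  · rw [← hb, hv]
    apply le_of_eq
    field_simp
  · apply le_of_eq
    rw [hκ]; field_simp; norm_num

/-! ### Combination of the three terms. -/

theorem mainTheorem10 :
    ∃ c : ℝ, 0 < c ∧
      ∀ (M K R : ℕ) (H Δ σ τ ζ : ℝ), 0 < M → 0 < K → 0 < R →
        0 < H → 0 < Δ → 0 ≤ σ → 0 ≤ τ → 0 ≤ ζ →
        σ ^ 2 ≤ (M * K * R : ℝ) * (Δ * H) →
        ∃ (d : ℕ) (P : ProblemInstance d M),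
          P.Smooth H ∧ P.BoundedSubopt Δ ∧ P.BoundedSecondHet τ ∧ P.BoundedFirstHet H ζ ∧
          P.OracleConditions H σ ∧
          ∀ (Ω : Type) [MeasurableSpace Ω] (μ : Measure Ω) [IsProbabilityMeasure μ]
            (A : DistAlgorithm d M Ω), A.ZeroRespecting → A.Centralized →
            ENNReal.ofReal (c * (Δ * H / R + σ ^ 2 / (M * K * R)
                + (σ * Δ * H / (M * K * R)) ^ (2 / 3 : ℝ)))
              ≤ A.expectedSqGrad μ P K R := by
  have hB := one_le_bumpBound
  set b := 20 * bumpBound with hb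
  have hb1 : 1 ≤ b := by linarith
  have hb0 : 0 < b := by linarith
  -- `6144 = 3 * 2048`: the sum is at most three times its largest term, and `2048 * b ^ 2` is the
  -- largest loss among the three instances.
  refine ⟨1 / (6144 * b ^ 2), by positivity, ?_⟩
  intro M K R H Δ σ τ ζ hM hK hR hH hΔ hσ hτ hζ hσ2
  have hN : (1 : ℝ) ≤ M * K * R := by exact_mod_cast Nat.mul_pos (Nat.mul_pos hM hK) hR
  have hR1 : (1 : ℝ) ≤ R := by exact_mod_cast hR
  have hMK : (1 : ℝ) ≤ M * K := by exact_mod_cast Nat.mul_pos hM hK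
  set x := σ * Δ * H / (M * K * R) with hx
  have hx0 : 0 ≤ x := by positivity
  set u := x ^ (1 / 3 : ℝ) with hu
  have hu0 : 0 ≤ u := Real.rpow_nonneg hx0 _
  have hu3 : u ^ 3 = x := by
    rw [hu, ← Real.rpow_natCast, ← Real.rpow_mul hx0]; norm_num
  have hu2 : x ^ (2 / 3 : ℝ) = u ^ 2 := by
    rw [hu, ← Real.rpow_natCast, ← Real.rpow_mul hx0]; norm_num
  rw [hu2]
  change HardInstance M K R H Δ σ τ ζ _
  set A₁ := Δ * H / R with hA₁
  set A₂ := σ ^ 2 / (M * K * R) with hA₂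
  have h1 : 0 < A₁ := by positivity
  have h2 : 0 ≤ A₂ := by positivity
  have hmono : ∀ A C : ℝ, 0 < C → C ≤ 2048 * b ^ 2 → A₁ ≤ A → A₂ ≤ A → u ^ 2 ≤ A →
      1 / (6144 * b ^ 2) * (A₁ + A₂ + u ^ 2) ≤ A / C := by
    intro A C hC hCb a1 a2 a3
    calc 1 / (6144 * b ^ 2) * (A₁ + A₂ + u ^ 2) ≤ 1 / (6144 * b ^ 2) * (3 * A) := by
          gcongr; linarith
      _ = A / (2048 * b ^ 2) := by field_simp; ring
      _ ≤ A / C := by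
          have : 0 ≤ A := h2.trans a2
          gcongr
  by_cases c1 : A₂ ≤ A₁ ∧ u ^ 2 ≤ A₁
  · exact (HardInstance.of_optimization_term hM hR hH hΔ hτ hζ).mono
      (hmono A₁ _ (by positivity) (by nlinarith) le_rfl c1.1 c1.2)
  by_cases c2 : A₁ ≤ A₂ ∧ u ^ 2 ≤ A₂
  · exact (HardInstance.of_variance_term hM hK hR hH hτ hζ hσ2).mono
      (hmono A₂ 4 (by norm_num) (by nlinarith) c2.1 le_rfl c2.2)
  have c3 : A₁ ≤ u ^ 2 ∧ A₂ ≤ u ^ 2 := by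
    rw [not_and_or, not_le, not_le] at c1 c2
    rcases le_total A₁ A₂ with h | h <;> constructor <;>
      rcases c1 with c1 | c1 <;> rcases c2 with c2 | c2 <;> linarith
  have hupos : 0 < u := by
    rcases hu0.eq_or_lt with h | h
    · rw [← h] at c3; norm_num at c3; linarith [c3.1]
    · exact h
  have hσpos : 0 < σ := by
    rcases hσ.eq_or_lt with h | h
    · have : u ^ 3 = 0 := by rw [hu3, hx, ← h]; simp
      linarith [pow_pos hupos 3]
    · exact h
  -- `u ^ 3 = σ * A₁ / (M * K) ≤ σ * A₁ ≤ σ * u ^ 2`, since `u ^ 2` dominates the optimization term.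
  have huσ : u ≤ σ := by
    have h3 : x ≤ σ * A₁ := by
      rw [hx, hA₁, ← mul_div_assoc, ← mul_assoc]
      apply div_le_div_of_nonneg_left (by positivity) (by positivity)
      nlinarith
    have h4 : u * u ^ 2 ≤ σ * u ^ 2 := by
      calc u * u ^ 2 = x := by rw [← hu3]; ring
        _ ≤ σ * A₁ := h3
        _ ≤ σ * u ^ 2 := by gcongr; exact c3.1
    exact le_of_mul_le_mul_right h4 (by positivity)
  exact (HardInstance.of_mixed_term hM hK hR hH hτ hζ hσpos hupos hu3 huσ c3.2).mono
    (hmono _ _ (by positivity) le_rfl c3.1 c3.2 le_rfl)
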